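/- Let $G$ be a locally compact, second countable, Hausdorff topological group, and let $P\subset G$ be a Borel subsemigroup with non-empty interior such that $PP^{-1}=G$. Let $Q\subset P$ be a Borel subsemigroup which is cofinal in $P$ (for every $x\in P$ there are $f\in Q$ and $a\in P$ with $f=xa$) and such that $QQ^{-1}$ is a closed subgroup of $G$. Let $E$ be a product system over $P$, and let $E|_Q$ be its restriction to $Q$. If $E|_Q$ is concrete, then $E$ is concrete. Here the terms have the following meaning, for a Borel subsemigroup $S$ of $G$ (with its Borel $\sigma$-algebra). A *product system* over $S$ is a measurable field $E=(E(x))_{x\in S}$ of non-zero separable complex Hilbert spaces, with space $\Gamma$ of measurable sections, together with an associative product on $\coprod_{x\in S}E(x)$ such that (i) for all $x,y\in S$ one has $uv\in E(xy)$ for $u\in E(x)$, $v\in E(y)$, and $u\otimes v\mapsto uv$ extends to a unitary $E(x)\otimes E(y)\to E(xy)$; (ii) for all $r,s,t\in\Gamma$ the map $(x,y)\mapsto\langle r(x)s(y)\,|\,t(xy)\rangle$ is measurable on $S\times S$. The restriction of a product system over $P$ to $Q$ has fibres $E(x)$, $x\in Q$, the same product, and as measurable sections the restrictions to $Q$ of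 the measurable sections of $E$. Two product systems $E,F$ over $S$ are *isomorphic* if there are unitaries $\theta_x:E(x)\to F(x)$ $(x\in S)$ with $\theta_{xy}(uv)=\theta_x(u)\theta_y(v)$ for $u\in E(x)$, $v\in E(y)$, which form a measurable field of operators, i.e. map measurable sections to measurable sections. An *$E_0$-semigroup* over $S$ on $B(H)$, where $H$ is a separable complex Hilbert space, is a family $\alpha=(\alpha_x)_{x\in S}$ of unital normal $*$-endomorphisms of $B(H)$ with $\alpha_x\circ\alpha_y=\alpha_{xy}$ such that $x\mapsto\langle\alpha_x(A)\xi\,|\,\eta\rangle$ is measurable for all $A\in B(H)$ and $\xi,\eta\in H$. Its associated product system $E_\alpha$ has fibres $E_\alpha(x)=\{T\in B(H):\alpha_x(A)T=TA\text{ for all }A\in B(H)\}$ with inner product $\langle S\,|\,T\rangle 1=T^*S$, composition of operators as product, and the weakly measurable sections as measurable sections. A product system over $S$ is *concrete* if it is isomorphic to $E_\alpha$ for some $E_0$-semigroup $\alpha$ over $S$ on $B(H)$ for some separable Hilbert space $H$. -/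

import Mathlib

open scoped TensorProduct Pointwise InnerProductSpace

noncomputable section

/-- The data underlying a product system over a measurable semigroup `P`: a field
`x ↦ E(x)` of inner product spaces, a product `E(x) × E(y) → E(xy)`, and a set of sections
(the measurable ones). The laws are in `ProductSystemData.IsProductSystem`. -/
structure ProductSystemData.{u, v} (P : Type u) [Mul P] where
  fiber : P → Type v
  [normedAddCommGroup : ∀ x, NormedAddCommGroup (fiber x)]
  [innerProductSpace : ∀ x, InnerProductSpace ℂ (fiber x)]
  mul : ∀ {x y : P}, fiber x → fiber y → fiber (x * y)
  sections : Set (∀ x, fiber x)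

attribute [instance] ProductSystemData.normedAddCommGroup ProductSystemData.innerProductSpace

namespace ProductSystemData

/-- `(E(x))_{x ∈ P}` is a measurable field of separable Hilbert spaces whose space of measurable
sections is `E.sections`: inner products of measurable sections are measurable functions, a
section whose inner products with all measurable sections are measurable is itself measurable,
and some sequence of measurable sections is total in every fibre. -/
structure IsMeasurableField {P : Type*} [Mul P] [MeasurableSpace P]
    (E : ProductSystemData P) : Prop where
  measurable_inner : ∀ s ∈ E.sections, ∀ t ∈ E.sections,
    Measurable fun x => inner ℂ (s x) (t x)
  mem_of_measurable_inner : ∀ t : ∀ x, E.fiber x,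
    (∀ s ∈ E.sections, Measurable fun x => inner ℂ (s x) (t x)) → t ∈ E.sections
  exists_total : ∃ e : ℕ → ∀ x, E.fiber x, (∀ n, e n ∈ E.sections) ∧
    ∀ x, Dense (Submodule.span ℂ (Set.range fun n => e n x) : Set (E.fiber x))

/-- `E` is a product system over `P`. The Hilbert space tensor product of `E(x)` and `E(y)` is
the completion of the algebraic tensor product with its canonical inner product. -/
structure IsProductSystem {P : Type*} [Mul P] [MeasurableSpace P]
    (E : ProductSystemData P) : Prop where
  complete : ∀ x, CompleteSpace (E.fiber x)
  separable : ∀ x, TopologicalSpace.SeparableSpace (E.fiber x)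
  nontrivial : ∀ x, Nontrivial (E.fiber x)
  mul_assoc : ∀ (x y z : P) (u : E.fiber x) (v : E.fiber y) (w : E.fiber z),
    (⟨x * y * z, E.mul (E.mul u v) w⟩ : Σ a, E.fiber a) =
      ⟨x * (y * z), E.mul u (E.mul v w)⟩
  exists_unitary : ∀ x y : P,
    ∃ U : UniformSpace.Completion (E.fiber x ⊗[ℂ] E.fiber y) ≃ₗᵢ[ℂ] E.fiber (x * y),
      ∀ (u : E.fiber x) (v : E.fiber y),
        U ((u ⊗ₜ[ℂ] v : E.fiber x ⊗[ℂ] E.fiber y) :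
          UniformSpace.Completion (E.fiber x ⊗[ℂ] E.fiber y)) = E.mul u v
  measurableField : E.IsMeasurableField
  measurable_mul : ∀ r ∈ E.sections, ∀ s ∈ E.sections, ∀ t ∈ E.sections,
    Measurable fun p : P × P => inner ℂ (t (p.1 * p.2)) (E.mul (r p.1) (s p.2))

/-- Isomorphism of product systems: a measurable field of unitaries `θ_x : E(x) → F(x)`
compatible with the products. Measurability of the field means that it maps measurable
sections to measurable sections. -/
def IsIsomorphic {P : Type*} [Mul P] (E F : ProductSystemData P) : Prop :=
  ∃ θ : ∀ x, E.fiber x ≃ₗᵢ[ℂ] F.fiber x,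
    (∀ (x y : P) (u : E.fiber x) (v : E.fiber y),
      θ (x * y) (E.mul u v) = F.mul (θ x u) (θ y v)) ∧
    ∀ s ∈ E.sections, (fun x => θ x (s x)) ∈ F.sections

/-- The restriction `E|_Q` to a subsemigroup `Q ⊆ P`: its measurable sections are the
restrictions to `Q` of the measurable sections of `E`. -/
def restrict {G : Type*} [Mul G] {P Q : Subsemigroup G} (E : ProductSystemData P)
    (h : Q ≤ P) : ProductSystemData Q where
  fiber x := E.fiber (Subsemigroup.inclusion h x)
  normedAddCommGroup _ := inferInstance
  innerProductSpace _ := inferInstance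
  mul {x y} u v := E.mul (x := Subsemigroup.inclusion h x) (y := Subsemigroup.inclusion h y) u v
  sections := (fun s x => s (Subsemigroup.inclusion h x)) '' E.sections

end ProductSystemData

/-- A linear map on `B(H)` is normal if it preserves suprema of bounded increasing nets of
self-adjoint operators. -/
def IsNormalMap {H : Type*} [NormedAddCommGroup H] [InnerProductSpace ℂ H] [CompleteSpace H]
    (f : (H →L[ℂ] H) → (H →L[ℂ] H)) : Prop :=
  ∀ (S : Set (H →L[ℂ] H)) (A : H →L[ℂ] H), S.Nonempty → DirectedOn (· ≤ ·) S →
    (∀ T ∈ S, IsSelfAdjoint T) → IsLUB S A → IsLUB (f '' S) (f A)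

/-- An `E₀`-semigroup over `P` on `B(H)`: a semigroup `α_x α_y = α_{xy}` of unital normal
`*`-endomorphisms of `B(H)`, weakly measurable in `x`. -/
structure E0Semigroup (P : Type*) [Mul P] [MeasurableSpace P] (H : Type*)
    [NormedAddCommGroup H] [InnerProductSpace ℂ H] [CompleteSpace H] where
  toHom : P → (H →L[ℂ] H) →⋆ₐ[ℂ] (H →L[ℂ] H)
  map_mul : ∀ x y A, toHom (x * y) A = toHom x (toHom y A)
  normal : ∀ x, IsNormalMap (toHom x)
  measurable : ∀ (A : H →L[ℂ] H) (ξ η : H), Measurable fun x => inner ℂ η (toHom x A ξ)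

/-- An operator commuting with all of `B(H)` is a scalar (normalised to be `0` if `H = 0`). -/
theorem exists_scalar_of_commute {H : Type*} [NormedAddCommGroup H] [InnerProductSpace ℂ H]
    (T : H →L[ℂ] H) (hT : ∀ A : H →L[ℂ] H, A * T = T * A) :
    ∃ c : ℂ, T = c • 1 ∧ (Subsingleton H → c = 0) := by
  rcases subsingleton_or_nontrivial H with hH | hH
  · exact ⟨0, by ext ξ; exact Subsingleton.elim _ _, fun _ => rfl⟩
  · obtain ⟨e, he⟩ := exists_ne (0 : H)
    have hne : inner ℂ e e ≠ (0 : ℂ) := inner_self_ne_zero.mpr he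
    refine ⟨inner ℂ e (T e) / inner ℂ e e, ?_, fun h => absurd (Subsingleton.elim e 0) he⟩
    ext ξ
    have h1 : inner ℂ e (T e) • ξ = T (inner ℂ e e • ξ) :=
      congrArg (fun B : H →L[ℂ] H => B e) (hT ((innerSL ℂ e).smulRight ξ))
    rw [map_smul] at h1
    change T ξ = (inner ℂ e (T e) / inner ℂ e e : ℂ) • ξ
    rw [div_eq_inv_mul, mul_smul, h1, smul_smul, inv_mul_cancel₀ hne, one_smul]

namespace E0Semigroup

variable {P : Type*} [Mul P] [MeasurableSpace P] {H : Type*}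
    [NormedAddCommGroup H] [InnerProductSpace ℂ H] [CompleteSpace H]

/-- The intertwining space `{T ∈ B(H) : α_x(A) T = T A for all A ∈ B(H)}`. -/
def intertwiner (α : E0Semigroup P H) (x : P) : Submodule ℂ (H →L[ℂ] H) where
  carrier := {T | ∀ A : H →L[ℂ] H, α.toHom x A * T = T * A}
  add_mem' {S T} hS hT A := by rw [mul_add, hS A, hT A, add_mul]
  zero_mem' A := by simp
  smul_mem' c T hT A := by rw [mul_smul_comm, hT A, smul_mul_assoc]

theorem adjoint_mul_scalar (α : E0Semigroup P H) (x : P) (S T : α.intertwiner x) :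
    ∃ c : ℂ, star (T : H →L[ℂ] H) * (S : H →L[ℂ] H) = c • 1 ∧ (Subsingleton H → c = 0) := by
  refine exists_scalar_of_commute _ fun A => ?_
  have h1 : α.toHom x A * (S : H →L[ℂ] H) = S * A := S.2 A
  have h2 : α.toHom x (star A) * (T : H →L[ℂ] H) = T * star A := T.2 (star A)
  have h3 := congrArg star h2
  rw [star_mul, star_mul, star_star, map_star, star_star] at h3
  rw [← mul_assoc, ← h3, mul_assoc, h1, mul_assoc]

/-- The scalar `c` with `T* S = c 1`. -/
def scalar (α : E0Semigroup P H) (x : P) (S T : α.intertwiner x) : ℂ :=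
  (α.adjoint_mul_scalar x S T).choose

theorem scalar_spec (α : E0Semigroup P H) (x : P) (S T : α.intertwiner x) :
    star (T : H →L[ℂ] H) * (S : H →L[ℂ] H) = α.scalar x S T • 1 :=
  (α.adjoint_mul_scalar x S T).choose_spec.1

theorem scalar_eq (α : E0Semigroup P H) (x : P) (S T : α.intertwiner x) (c : ℂ)
    (h : star (T : H →L[ℂ] H) * (S : H →L[ℂ] H) = c • 1) (h0 : Subsingleton H → c = 0) :
    α.scalar x S T = c := by
  rcases subsingleton_or_nontrivial H with hH | hH
  · rw [h0 hH]
    exact (α.adjoint_mul_scalar x S T).choose_spec.2 hH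
  · exact smul_left_injective ℂ (one_ne_zero (α := H →L[ℂ] H))
      ((α.scalar_spec x S T).symm.trans h)

theorem scalar_zero (α : E0Semigroup P H) (x : P) (S T : α.intertwiner x)
    (h : Subsingleton H) : α.scalar x S T = 0 :=
  (α.adjoint_mul_scalar x S T).choose_spec.2 h

/-- The inner product of the intertwining space, `⟨S | T⟩ = T* S` (linear in `S`); in Mathlib's
order of arguments this is `inner ℂ T S`. Its norm is the operator norm. -/
instance intertwinerInnerProductSpace (α : E0Semigroup P H) (x : P) :
    InnerProductSpace ℂ (α.intertwiner x) where
  inner T S := α.scalar x S T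
  norm_sq_eq_re_inner T := by
    have h := α.scalar_spec x T T
    rcases subsingleton_or_nontrivial H with hH | hH
    · have : T = 0 := Subtype.ext (by ext ξ; exact Subsingleton.elim _ _)
      rw [α.scalar_zero x T T hH, this]
      simp
    · obtain ⟨e, he⟩ := exists_ne (0 : H)
      have hc : ((‖(T : H →L[ℂ] H) e‖ : ℂ)) ^ 2 = α.scalar x T T * (‖e‖ : ℂ) ^ 2 := by
        have h1 : inner ℂ e (star (T : H →L[ℂ] H) ((T : H →L[ℂ] H) e)) =
            inner ℂ e (α.scalar x T T • e) :=
          congrArg (fun B : H →L[ℂ] H => (inner ℂ e (B e) : ℂ)) h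
        rw [ContinuousLinearMap.star_eq_adjoint, ContinuousLinearMap.adjoint_inner_right,
          inner_smul_right, inner_self_eq_norm_sq_to_K, inner_self_eq_norm_sq_to_K] at h1
        exact h1
      have hr : α.scalar x T T = ((‖(T : H →L[ℂ] H) e‖ ^ 2 / ‖e‖ ^ 2 : ℝ) : ℂ) := by
        have : (‖e‖ : ℂ) ≠ 0 := by simpa using he
        push_cast
        field_simp
        exact hc.symm
      have hn : ‖(T : H →L[ℂ] H)‖ * ‖(T : H →L[ℂ] H)‖ = ‖α.scalar x T T‖ := by
        rw [← CStarRing.norm_star_mul_self, h, norm_smul, norm_one, mul_one]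
      have hn' : ‖T‖ ^ 2 = ‖α.scalar x T T‖ := by rw [← hn, sq]; rfl
      rw [hn', hr, Complex.norm_real, Real.norm_of_nonneg (by positivity)]
      exact (Complex.ofReal_re _).symm
  conj_inner_symm S T := by
    refine (α.scalar_eq x T S _ ?_ fun h => ?_).symm
    · have h := congrArg star (α.scalar_spec x S T)
      simpa [star_mul, star_smul] using h
    · simp [α.scalar_zero x S T h]
  add_left S T R := by
    refine α.scalar_eq x R (S + T) _ ?_ fun h => ?_
    · rw [add_smul, ← α.scalar_spec, ← α.scalar_spec, Submodule.coe_add, star_add, add_mul]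
    · simp [α.scalar_zero x _ _ h]
  smul_left S T c := by
    refine α.scalar_eq x T (c • S) _ ?_ fun h => ?_
    · rw [mul_smul, ← α.scalar_spec, Submodule.coe_smul, star_smul, smul_mul_assoc]
      rfl
    · simp [α.scalar_zero x _ _ h]

/-- The product system associated with an `E₀`-semigroup: the fibres are the intertwining
spaces, the product is composition of operators, and the measurable sections are the weakly
measurable ones. -/
def productSystem (α : E0Semigroup P H) : ProductSystemData P where
  fiber x := α.intertwiner x
  normedAddCommGroup _ := inferInstance
  innerProductSpace _ := inferInstance
  mul {x y} S T := ⟨(S : H →L[ℂ] H) * (T : H →L[ℂ] H), fun A => by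
    have hS := S.2 (α.toHom y A)
    have hT := T.2 A
    rw [α.map_mul, ← mul_assoc, hS, mul_assoc, hT, mul_assoc]⟩
  sections := {f | ∀ ξ η : H, Measurable fun x => inner ℂ η ((f x : H →L[ℂ] H) ξ)}

end E0Semigroup

/-- A product system is concrete if it is isomorphic to the product system associated with an
`E₀`-semigroup on `B(H)` for a separable Hilbert space `H`. Up to unitary equivalence every
separable Hilbert space is in the universe `Type`. -/
def ProductSystemData.IsConcrete {P : Type*} [Mul P] [MeasurableSpace P]
    (E : ProductSystemData P) : Prop :=
  ∃ (H : Type) (_ : NormedAddCommGroup H) (_ : InnerProductSpace ℂ H) (_ : CompleteSpace H)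
    (_ : TopologicalSpace.SeparableSpace H) (α : E0Semigroup P H),
    E.IsIsomorphic α.productSystem

/-- `Q ⊆ P` is cofinal in `P` for the order `x ≤ y` iff `y = x a` for some `a ∈ P`. -/
def IsCofinalIn {G : Type*} [Mul G] (Q P : Set G) : Prop :=
  ∀ x ∈ P, ∃ f ∈ Q, ∃ a ∈ P, f = x * a

end

/-!
Every product system `E` over a Borel semigroup `P` with non-empty interior and `P P⁻¹ = G` has an
essential representation on a separable Hilbert space, and is therefore concrete
(`ProductSystemData.IsProductSystem.isConcrete`). The representation is an induced one, of the kind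
used by Skeide for Arveson systems, with inductive limits in place of a representation of a
cofinal subsemigroup.

The sets `P d⁻¹`, `d ∈ P`, cover `G` and contain open sets that still cover; by Lindelöf countably
many suffice, and by the Ore property of `P` they can be made increasing: there are `qₙ, rₙ ∈ P`
with `qₙ₊₁ = qₙ rₙ` and `G = ⋃ P qₙ⁻¹`. Choose unit vectors `eₙ ∈ E(rₙ)` (`exists_tower`). Right
multiplication by `eₙ` embeds `E(g qₙ)` isometrically into `E(g qₙ₊₁)`, for all `n` so large that
`g qₙ ∈ P`; let `K(g)` be the inductive limit. Left multiplication by `E(x)` commutes with right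
multiplication, and gives a unitary `E(x) ⊗ K(g) → K(xg)`: it is onto because an element of
`K(xg)` sits in some `E(x g qₙ)` with `g qₙ ∈ P`, and `E(x) E(g qₙ)` is total there.

The representation space is the completion of the space `V` (`Tower.LimitSpace`) of square
integrable sections of `g ↦ K(g)` for left Haar measure, with `(u F)(xg) = u F(g)` for `u ∈ E(x)`.
An element of `V` is encoded as a sequence of measurable sections `Fₙ` of `E`, with `Fₙ(g qₙ)`
the element of `E(g qₙ)` representing it, such that `Fₙ₊₁` is `Fₙ` multiplied from the right by
`eₙ` once `n` is large. Left invariance of the measure gives `⟨u F, v F'⟩ = ⟨u, v⟩ ⟨F, F'⟩`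
(`Tower.LimitSpace.inner_lmul`). For totality of `E(x) V`
(`Tower.LimitSpace.dense_span_lmul`), `F` is first cut off to the sets `{g | x⁻¹ g q_M ∈ P}`, which
exhaust `G`, and then written as `∑ eᵢ eᵢ* F` with an orthonormal basis `eᵢ` of `E(x)`. Measurability
is Fubini's theorem, and `V` is separable since the sections with a fixed level embed into
`L²(G × ℕ)` through their coefficients in a measurable orthonormal frame of `E`.

Finally, an essential representation `φ` on `H` identifies `H` with `E(x) ⊗ H`, and
`α_x(A) = 1 ⊗ A` is an `E₀`-semigroup whose product system is isomorphic to `E`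
(`EssentialRep.isConcrete`). Its normality follows from Vigier's theorem
(`tendsto_inner_of_isLUB`); its measurability from the expansion
`α_x(A) = ∑ φ(eₙ(x)) A φ(eₙ(x))*` in a measurable orthonormal frame.
-/

noncomputable section

open Filter Topology

/-! ### Tensor products of Hilbert spaces, in terms of operators -/

section Hilbert

variable {L K H : Type*} [NormedAddCommGroup L] [InnerProductSpace ℂ L]
  [NormedAddCommGroup K] [InnerProductSpace ℂ K] [NormedAddCommGroup H] [InnerProductSpace ℂ H]

/-- A bilinear map `L × K → H` which extends to a unitary from the Hilbert space tensor product of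
`L` and `K` onto `H`, in the form of a linear map into operators. -/
structure IsTensorAction (m : L →ₗ[ℂ] (K →L[ℂ] H)) : Prop where
  inner_apply : ∀ u v ξ η, inner ℂ (m u ξ) (m v η) = inner ℂ u v * inner ℂ ξ η
  dense : Dense (Submodule.span ℂ {ζ | ∃ u ξ, m u ξ = ζ} : Set H)

/-- A total sequence of pairwise orthogonal vectors, each of them zero or of norm one. -/
structure IsOrthoFrame (e : ℕ → L) : Prop where
  orthogonal : Pairwise fun i j => inner ℂ (e i) (e j) = 0
  norm_eq : ∀ n, e n = 0 ∨ ‖e n‖ = 1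
  dense : Dense (Submodule.span ℂ (Set.range e) : Set L)

theorem IsOrthoFrame.inner_smul_self {e : ℕ → L} (he : IsOrthoFrame e) (n : ℕ) :
    inner ℂ (e n) (e n) • e n = e n := by
  rcases he.norm_eq n with h | h
  · simp [h]
  · rw [inner_self_eq_norm_sq_to_K, h]; simp

/-- To check a closed linear condition on `H` it suffices to check it on the vectors `m u ξ`. -/
theorem IsTensorAction.induction {m : L →ₗ[ℂ] (K →L[ℂ] H)} (hm : IsTensorAction m)
    {S : Submodule ℂ H} (hS : IsClosed (S : Set H)) (h : ∀ u ξ, m u ξ ∈ S) (ζ : H) : ζ ∈ S := by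
  have h1 : Submodule.span ℂ {ζ | ∃ u ξ, m u ξ = ζ} ≤ S := by
    rw [Submodule.span_le]; rintro _ ⟨u, ξ, rfl⟩; exact h u ξ
  exact closure_minimal h1 hS (hm.dense ζ)

theorem IsTensorAction.ext {F : Type*} [NormedAddCommGroup F] [InnerProductSpace ℂ F]
    {m : L →ₗ[ℂ] (K →L[ℂ] H)} (hm : IsTensorAction m) {S T : H →L[ℂ] F}
    (h : ∀ u ξ, S (m u ξ) = T (m u ξ)) : S = T := by
  ext ζ
  have := hm.induction (S := LinearMap.ker (S - T : H →L[ℂ] F).toLinearMap)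
    (S - T : H →L[ℂ] F).isClosed_ker
    (fun u ξ => by simp [h]) ζ
  simpa [sub_eq_zero] using this

theorem IsTensorAction.ext_inner {m : L →ₗ[ℂ] (K →L[ℂ] H)} (hm : IsTensorAction m) {a b : H}
    (h : ∀ u ξ, inner ℂ (m u ξ) a = inner ℂ (m u ξ) b) : a = b := by
  refine ext_inner_left ℂ fun ζ => ?_
  have := hm.induction (S := (Submodule.span ℂ {a - b})ᗮ) (Submodule.isClosed_orthogonal _)
    (fun u ξ => by
      rw [Submodule.mem_orthogonal_singleton_iff_inner_left, inner_sub_right, h, sub_self]) ζ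
  rwa [Submodule.mem_orthogonal_singleton_iff_inner_left, inner_sub_right, sub_eq_zero] at this

theorem IsTensorAction.norm_apply {m : L →ₗ[ℂ] (K →L[ℂ] H)} (hm : IsTensorAction m) (u : L)
    (ξ : K) : ‖m u ξ‖ = ‖u‖ * ‖ξ‖ := by
  have h := hm.inner_apply u u ξ ξ
  rw [inner_self_eq_norm_sq_to_K, inner_self_eq_norm_sq_to_K, inner_self_eq_norm_sq_to_K] at h
  have h2 : ‖m u ξ‖ ^ 2 = (‖u‖ * ‖ξ‖) ^ 2 := by
    rw [mul_pow]; exact_mod_cast h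
  exact (sq_eq_sq₀ (norm_nonneg _) (by positivity)).mp h2

section Adjoint

variable [CompleteSpace K] [CompleteSpace H]

open ContinuousLinearMap (adjoint)

theorem IsTensorAction.adjoint_apply {m : L →ₗ[ℂ] (K →L[ℂ] H)} (hm : IsTensorAction m) (u v : L)
    (ξ : K) : adjoint (m u) (m v ξ) = inner ℂ u v • ξ := by
  refine ext_inner_left ℂ fun η => ?_
  rw [ContinuousLinearMap.adjoint_inner_right, hm.inner_apply, inner_smul_right]

/-- The operator `∑_{n < k} m(eₙ) m(eₙ)*`; an orthogonal projection if `e` is an orthonormal frame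
and `m` a tensor action. -/
def frameProj (m : L →ₗ[ℂ] (K →L[ℂ] H)) (e : ℕ → L) (k : ℕ) (ζ : H) : H :=
  ∑ n ∈ Finset.range k, m (e n) (adjoint (m (e n)) ζ)

theorem inner_frameProj (m : L →ₗ[ℂ] (K →L[ℂ] H)) (e : ℕ → L) (k : ℕ) (η ζ : H) :
    inner ℂ η (frameProj m e k ζ) =
      ∑ n ∈ Finset.range k, inner ℂ (adjoint (m (e n)) η) (adjoint (m (e n)) ζ) := by
  simp only [frameProj, inner_sum, ContinuousLinearMap.adjoint_inner_left]

theorem norm_frameProj_le {m : L →ₗ[ℂ] (K →L[ℂ] H)} (hm : IsTensorAction m) {e : ℕ → L}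
    (he : IsOrthoFrame e) (k : ℕ) (ζ : H) : ‖frameProj m e k ζ‖ ≤ ‖ζ‖ := by
  have h : inner ℂ (frameProj m e k ζ) (frameProj m e k ζ) = inner ℂ (frameProj m e k ζ) ζ := by
    rw [← inner_conj_symm (frameProj m e k ζ) ζ, inner_frameProj m e k ζ, map_sum]
    conv_lhs => rw [frameProj, sum_inner]
    refine Finset.sum_congr rfl fun i hi => ?_
    rw [inner_sum, Finset.sum_eq_single i]
    · rw [hm.inner_apply, inner_conj_symm]
      rcases he.norm_eq i with h | h
      · simp [h]
      · rw [inner_self_eq_norm_sq_to_K, h]; simp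
    · intro j _ hj
      rw [hm.inner_apply, he.orthogonal hj.symm, zero_mul]
    · exact fun h => absurd hi h
  have h1 : ‖frameProj m e k ζ‖ * ‖frameProj m e k ζ‖ ≤ ‖frameProj m e k ζ‖ * ‖ζ‖ := by
    calc _ = ‖inner ℂ (frameProj m e k ζ) (frameProj m e k ζ)‖ := by
          rw [inner_self_eq_norm_sq_to_K]; simp [sq]
      _ ≤ _ := by rw [h]; exact norm_inner_le_norm _ _
  rcases (norm_nonneg (frameProj m e k ζ)).eq_or_lt with h0 | h0
  · rw [← h0]; exact norm_nonneg _
  · exact le_of_mul_le_mul_left h1 h0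

/-- The projections `∑_{n < k} m(eₙ) m(eₙ)*` increase to the identity. -/
theorem tendsto_frameProj {m : L →ₗ[ℂ] (K →L[ℂ] H)} (hm : IsTensorAction m) {e : ℕ → L}
    (he : IsOrthoFrame e) (ζ : H) : Tendsto (fun k => frameProj m e k ζ) atTop (𝓝 ζ) := by
  have hadd : ∀ k a b, frameProj m e k (a + b) = frameProj m e k a + frameProj m e k b := by
    intro k a b; simp [frameProj, Finset.sum_add_distrib]
  have hsmul : ∀ k (c : ℂ) a, frameProj m e k (c • a) = c • frameProj m e k a := by
    intro k c a; simp [frameProj, Finset.smul_sum]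
  let S : Submodule ℂ H :=
    { carrier := {ζ | Tendsto (fun k => frameProj m e k ζ) atTop (𝓝 ζ)}
      add_mem' := fun {a b} ha hb => by
        simp only [Set.mem_ofPred_eq, hadd]; exact Tendsto.add ha hb
      zero_mem' := by simp [frameProj]
      smul_mem' := fun c a ha => by
        simp only [Set.mem_ofPred_eq, hsmul]; exact Tendsto.const_smul ha c }
  have hS : IsClosed (S : Set H) := by
    refine isClosed_of_closure_subset fun ζ hζ => ?_
    rw [Metric.mem_closure_iff] at hζ
    change Tendsto _ _ _
    rw [Metric.tendsto_atTop]
    intro ε hε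
    obtain ⟨b, hb, hbd⟩ := hζ (ε / 3) (by positivity)
    obtain ⟨N, hN⟩ := (Metric.tendsto_atTop.mp hb) (ε / 3) (by positivity)
    refine ⟨N, fun k hk => ?_⟩
    have h1 : frameProj m e k ζ - ζ =
        frameProj m e k (ζ - b) + (frameProj m e k b - b) + (b - ζ) := by
      rw [sub_eq_add_neg ζ b, hadd, ← neg_one_smul ℂ b, hsmul]; simp; abel
    have h2 := hN k hk
    rw [dist_eq_norm] at h2 hbd ⊢
    rw [h1]
    have h3 := norm_frameProj_le hm he k (ζ - b)
    have h4 : ‖b - ζ‖ < ε / 3 := by rw [norm_sub_rev]; exact hbd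
    linarith [norm_add₃_le (a := frameProj m e k (ζ - b)) (b := frameProj m e k b - b)
      (c := b - ζ)]
  refine hm.induction hS (fun u ξ => ?_) ζ
  let g : L →L[ℂ] H := LinearMap.mkContinuous
    { toFun := fun v => m v ξ, map_add' := by simp, map_smul' := by simp } ‖ξ‖
    fun v => by rw [mul_comm, ← hm.norm_apply]; exact le_rfl
  have h1 : Submodule.span ℂ (Set.range e) ≤ S.comap (g : L →ₗ[ℂ] H) := by
    rw [Submodule.span_le]
    rintro _ ⟨l, rfl⟩
    change Tendsto (fun k => frameProj m e k (m (e l) ξ)) atTop (𝓝 (m (e l) ξ))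
    refine tendsto_const_nhds.congr' ?_
    filter_upwards [eventually_gt_atTop l] with k hk
    rw [frameProj, Finset.sum_eq_single l]
    · rw [hm.adjoint_apply, map_smul, ← smul_apply, ← map_smul,
        he.inner_smul_self]
    · intro j _ hj
      rw [hm.adjoint_apply, he.orthogonal hj, zero_smul, map_zero]
    · intro h; exact absurd (Finset.mem_range.mpr hk) h
  exact closure_minimal h1 (hS.preimage g.continuous) (he.dense u)

/-- Parseval's identity in polarised form. -/
theorem tendsto_sum_inner_adjoint {m : L →ₗ[ℂ] (K →L[ℂ] H)} (hm : IsTensorAction m) {e : ℕ → L}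
    (he : IsOrthoFrame e) (η ζ : H) :
    Tendsto (fun k => ∑ n ∈ Finset.range k,
      inner ℂ (adjoint (m (e n)) η) (adjoint (m (e n)) ζ)) atTop (𝓝 (inner ℂ η ζ)) := by
  simp only [← inner_frameProj]
  exact tendsto_const_nhds.inner (tendsto_frameProj hm he ζ)

end Adjoint

/-- Scalar multiplication `L × ℂ → L`, as a linear map into operators. -/
def spanSingletonₗ (L : Type*) [NormedAddCommGroup L] [InnerProductSpace ℂ L] :
    L →ₗ[ℂ] (ℂ →L[ℂ] L) where
  toFun u := ContinuousLinearMap.toSpanSingleton ℂ u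
  map_add' u v := by ext; simp
  map_smul' c u := by ext; simp

theorem isTensorAction_spanSingletonₗ : IsTensorAction (spanSingletonₗ L) where
  inner_apply u v c d := by
    simp [spanSingletonₗ]; ring
  dense := by
    have : {ζ : L | ∃ (u : L) (c : ℂ), spanSingletonₗ L u c = ζ} = Set.univ := by
      ext ζ; simpa using ⟨ζ, 1, by simp [spanSingletonₗ]⟩
    simp [this]

theorem adjoint_spanSingletonₗ [CompleteSpace L] (u v : L) :
    ContinuousLinearMap.adjoint (spanSingletonₗ L u) v = inner ℂ u v := by
  change ContinuousLinearMap.adjoint (ContinuousLinearMap.toSpanSingleton ℂ u) v = _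
  rw [ContinuousLinearMap.adjoint_toSpanSingleton]; rfl

theorem isOrthoFrame_gramSchmidtNormed {f : ℕ → L}
    (hf : Dense (Submodule.span ℂ (Set.range f) : Set L)) :
    IsOrthoFrame (InnerProductSpace.gramSchmidtNormed ℂ f) where
  orthogonal i j hij := by
    simp only [InnerProductSpace.gramSchmidtNormed, inner_smul_left, inner_smul_right,
      InnerProductSpace.gramSchmidt_orthogonal ℂ f hij, mul_zero]
  norm_eq n := by
    rw [or_iff_not_imp_left]
    exact fun h => InnerProductSpace.gramSchmidtNormed_unit_length' h
  dense := by rwa [InnerProductSpace.span_gramSchmidtNormed_range,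
    InnerProductSpace.span_gramSchmidt]

theorem exists_isOrthoFrame (L : Type*) [NormedAddCommGroup L] [InnerProductSpace ℂ L]
    [TopologicalSpace.SeparableSpace L] : ∃ e : ℕ → L, IsOrthoFrame e :=
  ⟨_, isOrthoFrame_gramSchmidtNormed
    ((TopologicalSpace.denseRange_denseSeq L).mono Submodule.subset_span)⟩

theorem IsOrthoFrame.hasSum_norm_sq [CompleteSpace L] {e : ℕ → L} (he : IsOrthoFrame e) (v : L) :
    HasSum (fun n => ‖inner ℂ (e n) v‖ ^ 2) (‖v‖ ^ 2) := by
  rw [hasSum_iff_tendsto_nat_of_nonneg (fun n => by positivity)]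
  have h := (Complex.continuous_re.tendsto _).comp
    (tendsto_sum_inner_adjoint isTensorAction_spanSingletonₗ he v v)
  convert! h using 2 with k
  · simp only [adjoint_spanSingletonₗ, Function.comp, Complex.re_sum]
    refine Finset.sum_congr rfl fun n _ => ?_
    rw [inner_self_eq_norm_sq_to_K]; norm_cast
  · rw [inner_self_eq_norm_sq_to_K]; norm_cast

/-- The extension of a tensor action to the algebraic tensor product is isometric. -/
theorem IsTensorAction.norm_lift {m : L →ₗ[ℂ] (K →L[ℂ] H)} (hm : IsTensorAction m)
    (t : L ⊗[ℂ] K) :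
    ‖TensorProduct.lift ((ContinuousLinearMap.coeLM ℂ).comp m : L →ₗ[ℂ] K →ₗ[ℂ] H) t‖ = ‖t‖ := by
  set Φ := TensorProduct.lift ((ContinuousLinearMap.coeLM ℂ).comp m : L →ₗ[ℂ] K →ₗ[ℂ] H)
  have h : ∀ s t, inner ℂ (Φ s) (Φ t) = inner ℂ s t := by
    intro s t
    induction s with
    | zero => simp
    | add a b ha hb => rw [map_add, inner_add_left, inner_add_left, ha, hb]
    | tmul u ξ =>
      induction t with
      | zero => simp
      | add a b ha hb => rw [map_add, inner_add_right, inner_add_right, ha, hb]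
      | tmul v η =>
        rw [TensorProduct.inner_tmul, ← hm.inner_apply]; rfl
  exact (Φ.isometryOfInner h).norm_map t

/-- Every bounded operator `A` on `K` acts on the right leg of a tensor product. By linearity `A`
may be taken unitary, and then the amplification is isometric on elementary tensors. -/
theorem IsTensorAction.exists_amplification [CompleteSpace K] [CompleteSpace H]
    {m : L →ₗ[ℂ] (K →L[ℂ] H)} (hm : IsTensorAction m) (A : K →L[ℂ] K) :
    ∃ T : H →L[ℂ] H, ∀ u ξ, T (m u ξ) = m u (A ξ) := by
  have hA : A ∈ Submodule.span ℂ (unitary (K →L[ℂ] K) : Set (K →L[ℂ] K)) := by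
    rw [CStarAlgebra.span_unitary]; trivial
  induction hA using Submodule.span_induction with
  | zero => exact ⟨0, by simp⟩
  | add A B _ _ hA hB =>
    obtain ⟨S, hS⟩ := hA
    obtain ⟨T, hT⟩ := hB
    exact ⟨S + T, by simp [hS, hT]⟩
  | smul c A _ hA =>
    obtain ⟨S, hS⟩ := hA
    exact ⟨c • S, by simp [hS]⟩
  | mem A hA =>
    set Φ := TensorProduct.lift ((ContinuousLinearMap.coeLM ℂ).comp m : L →ₗ[ℂ] K →ₗ[ℂ] H)
    let V : K ≃ₗᵢ[ℂ] K := Unitary.linearIsometryEquiv ⟨A, hA⟩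
    have hd : DenseRange Φ := by
      refine hm.dense.mono ?_
      suffices h : Submodule.span ℂ {ζ | ∃ u ξ, m u ξ = ζ} ≤ LinearMap.range Φ from h
      refine Submodule.span_le.mpr ?_
      rintro _ ⟨u, ξ, rfl⟩
      exact ⟨u ⊗ₜ ξ, rfl⟩
    have hn : ∀ t, ‖(Φ.comp (V.toLinearIsometry.lTensor L).toLinearMap) t‖ ≤ 1 * ‖Φ t‖ := by
      intro t
      rw [one_mul, hm.norm_lift, LinearMap.comp_apply, hm.norm_lift]
      exact ((V.toLinearIsometry.lTensor L).norm_map t).le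
    refine ⟨(Φ.comp (V.toLinearIsometry.lTensor L).toLinearMap).extendOfNorm Φ, fun u ξ => ?_⟩
    exact LinearMap.extendOfNorm_eq hd ⟨1, hn⟩ (u ⊗ₜ ξ)

end Hilbert

section Operators

variable {H : Type*} [NormedAddCommGroup H] [InnerProductSpace ℂ H] [CompleteSpace H]

/-- Vigier's theorem, in the weak operator topology: a directed family of self-adjoint operators
with a supremum converges to it. -/
theorem tendsto_inner_of_isLUB {S : Set (H →L[ℂ] H)} {A : H →L[ℂ] H} (hne : S.Nonempty)
    (hdir : DirectedOn (· ≤ ·) S) (hsa : ∀ T ∈ S, IsSelfAdjoint T) (hA : IsLUB S A) (ξ η : H) :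
    Tendsto (fun T : S => inner ℂ ((T : H →L[ℂ] H) ξ) η) atTop (𝓝 (inner ℂ (A ξ) η)) := by
  have : Nonempty S := hne.to_subtype
  have : IsDirected S (· ≤ ·) := ⟨fun a b => by
    obtain ⟨c, hc, h1, h2⟩ := hdir a a.2 b b.2
    exact ⟨⟨c, hc⟩, h1, h2⟩⟩
  have : (atTop : Filter S).NeBot := atTop_neBot
  have hle : ∀ {S T : H →L[ℂ] H}, S ≤ T → ∀ x, (inner ℂ (S x) x).re ≤ (inner ℂ (T x) x).re := by
    intro S T h x
    have := ((ContinuousLinearMap.le_def S T).mp h).re_inner_nonneg_left x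
    simpa [inner_sub_left] using this
  have hreal : ∀ T : S, ∀ x, inner ℂ ((T : H →L[ℂ] H) x) x =
      ((inner ℂ ((T : H →L[ℂ] H) x) x).re : ℂ) := by
    intro T x
    refine (Complex.conj_eq_iff_re.mp ?_).symm
    rw [inner_conj_symm]
    exact ((ContinuousLinearMap.isSelfAdjoint_iff_isSymmetric.mp (hsa T T.2)) x x).symm
  -- the quadratic forms are increasing and bounded, so they converge; polarise
  have hquad : ∀ x, ∃ l : ℂ, Tendsto (fun T : S => inner ℂ ((T : H →L[ℂ] H) x) x) atTop (𝓝 l) := by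
    intro x
    refine ⟨_, (Complex.continuous_ofReal.tendsto _).comp (tendsto_atTop_ciSup
      (f := fun T : S => (inner ℂ ((T : H →L[ℂ] H) x) x).re) (fun a b h => hle h x) ?_) |>.congr
      fun T => (hreal T x).symm⟩
    exact ⟨(inner ℂ (A x) x).re, by rintro _ ⟨T, rfl⟩; exact hle (hA.1 T.2) x⟩
  have hlim : ∀ x y, ∃ l : ℂ,
      Tendsto (fun T : S => inner ℂ ((T : H →L[ℂ] H) x) y) atTop (𝓝 l) := by
    intro x y
    obtain ⟨a, ha⟩ := hquad (x + y)
    obtain ⟨b, hb⟩ := hquad (x - y)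
    obtain ⟨c, hc⟩ := hquad (x + Complex.I • y)
    obtain ⟨d, hd⟩ := hquad (x - Complex.I • y)
    refine ⟨_, ((((ha.sub hb).sub (hc.const_mul Complex.I)).add
      (hd.const_mul Complex.I)).div_const 4).congr fun T => ?_⟩
    exact (inner_map_polarization' (T : H →L[ℂ] H).toLinearMap x y).symm
  choose b hb using hlim
  obtain ⟨T₀⟩ := ‹Nonempty S›
  -- beyond `T₀` the norms are bounded
  have hbd : ∀ x y, ‖b x y‖ ≤ (‖A - T₀‖ + ‖(T₀ : H →L[ℂ] H)‖) * ‖x‖ * ‖y‖ := by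
    intro x y
    refine le_of_tendsto (hb x y).norm ?_
    filter_upwards [eventually_ge_atTop T₀] with T hT
    have h1 : ‖(T : H →L[ℂ] H) - T₀‖ ≤ ‖A - T₀‖ :=
      CStarAlgebra.norm_le_norm_of_nonneg_of_le (sub_nonneg.mpr hT)
        (sub_le_sub_right (hA.1 T.2) _)
    have h2 : ‖(T : H →L[ℂ] H)‖ ≤ ‖A - T₀‖ + ‖(T₀ : H →L[ℂ] H)‖ := by
      calc _ = ‖((T : H →L[ℂ] H) - T₀) + T₀‖ := by rw [sub_add_cancel]
        _ ≤ _ := (norm_add_le _ _).trans (by linarith)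
    calc _ ≤ ‖(T : H →L[ℂ] H) x‖ * ‖y‖ := norm_inner_le_norm _ _
      _ ≤ _ := by
        gcongr
        exact (T : H →L[ℂ] H).le_of_opNorm_le h2 x
  let B : H →ₗ⋆[ℂ] H →ₗ[ℂ] ℂ := LinearMap.mk₂'ₛₗ _ _ b
    (fun x x' y => tendsto_nhds_unique (hb _ _) (by
      simpa [inner_add_left] using (hb x y).add (hb x' y)))
    (fun c x y => tendsto_nhds_unique (hb _ _) (by
      simpa [inner_smul_left, mul_comm] using (hb x y).const_mul (starRingEnd ℂ c)))
    (fun x y y' => tendsto_nhds_unique (hb _ _) (by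
      simpa [inner_add_right] using (hb x y).add (hb x y')))
    (fun c x y => tendsto_nhds_unique (hb _ _) (by
      simpa [inner_smul_right] using (hb x y).const_mul c))
  let A' : H →L[ℂ] H := InnerProductSpace.continuousLinearMapOfBilin (B.mkContinuous₂ _ hbd)
  have hA' : ∀ x y, inner ℂ (A' x) y = b x y := fun x y =>
    InnerProductSpace.continuousLinearMapOfBilin_apply _ _ _
  have hA'T : ∀ x y, Tendsto (fun T : S => inner ℂ ((T : H →L[ℂ] H) x) y) atTop
      (𝓝 (inner ℂ (A' x) y)) := fun x y => by rw [hA']; exact hb x y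
  have hreal' : ∀ x, ((inner ℂ (A' x) x).re : ℂ) = inner ℂ (A' x) x := by
    intro x
    refine tendsto_nhds_unique (((Complex.continuous_ofReal.comp
      Complex.continuous_re).tendsto _).comp (hA'T x x)) ((hA'T x x).congr fun T => ?_)
    exact hreal T x
  have hub : A' ∈ upperBounds S := by
    intro T hT
    rw [ContinuousLinearMap.le_def, ContinuousLinearMap.isPositive_iff_complex]
    intro x
    have h1 := hreal ⟨T, hT⟩ x
    have h2 := hreal' x
    refine ⟨?_, ?_⟩
    · rw [_root_.sub_apply, inner_sub_left, ← h2, h1]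
      simp
    · rw [_root_.sub_apply, inner_sub_left, map_sub, sub_nonneg]
      refine ge_of_tendsto ((Complex.continuous_re.tendsto _).comp (hA'T x x)) ?_
      filter_upwards [eventually_ge_atTop ⟨T, hT⟩] with T' hT'
      exact hle hT' x
  have hle' : A' ≤ A := by
    rw [ContinuousLinearMap.le_def, ContinuousLinearMap.isPositive_iff_complex]
    intro x
    have h1 := ((ContinuousLinearMap.le_def _ _).mp (hA.1 T₀.2)).inner_nonneg_left x
    rw [_root_.sub_apply, inner_sub_left, hreal T₀ x] at h1
    have h3 : (inner ℂ (A x) x).im = 0 := by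
      have := (Complex.le_def.mp h1).2
      simpa using this.symm
    have h4 := hreal' x
    refine ⟨?_, ?_⟩
    · rw [_root_.sub_apply, inner_sub_left, ← h4]
      apply Complex.ext <;> simp [h3]
    · rw [_root_.sub_apply, inner_sub_left, map_sub, sub_nonneg]
      refine le_of_tendsto ((Complex.continuous_re.tendsto _).comp (hA'T x x)) ?_
      exact Eventually.of_forall fun T => hle (hA.1 T.2) x
  rw [le_antisymm (hA.2 hub) hle']
  exact hA'T ξ η

/-- Weakly measurable functions into a separable Hilbert space are strongly measurable. -/
theorem stronglyMeasurable_of_inner [TopologicalSpace.SeparableSpace H] {X : Type*}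
    [MeasurableSpace X] {f : X → H} (hf : ∀ η, Measurable fun x => inner ℂ η (f x)) :
    MeasureTheory.StronglyMeasurable f := by
  obtain ⟨e, he⟩ := exists_isOrthoFrame H
  refine stronglyMeasurable_of_tendsto (f := fun k x =>
    frameProj (spanSingletonₗ H) e k (f x)) atTop (fun k => ?_)
    (tendsto_pi_nhds.mpr fun x => tendsto_frameProj isTensorAction_spanSingletonₗ he (f x))
  refine Finset.stronglyMeasurable_fun_sum _ fun n _ => ?_
  simp only [adjoint_spanSingletonₗ]
  exact (hf (e n)).stronglyMeasurable.smul_const (e n)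

end Operators

/-! ### Essential representations and `E₀`-semigroups -/

section Sections

namespace ProductSystemData.IsMeasurableField

variable {P : Type*} [Mul P] [MeasurableSpace P] {E : ProductSystemData P}

theorem add_mem (hE : E.IsMeasurableField) {s t : ∀ x, E.fiber x} (hs : s ∈ E.sections)
    (ht : t ∈ E.sections) : (fun x => s x + t x) ∈ E.sections := by
  refine hE.mem_of_measurable_inner _ fun r hr => ?_
  simp only [inner_add_right]
  exact (hE.measurable_inner r hr s hs).add (hE.measurable_inner r hr t ht)

theorem smul_mem (hE : E.IsMeasurableField) {s : ∀ x, E.fiber x} (hs : s ∈ E.sections)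
    {c : P → ℂ} (hc : Measurable c) : (fun x => c x • s x) ∈ E.sections := by
  refine hE.mem_of_measurable_inner _ fun r hr => ?_
  simp only [inner_smul_right]
  exact hc.mul (hE.measurable_inner r hr s hs)

theorem zero_mem (hE : E.IsMeasurableField) : (fun _ => 0 : ∀ x, E.fiber x) ∈ E.sections := by
  refine hE.mem_of_measurable_inner _ fun r hr => ?_
  simp only [inner_zero_right]
  exact measurable_const

theorem sum_mem (hE : E.IsMeasurableField) {ι : Type*} (I : Finset ι) {s : ι → ∀ x, E.fiber x}
    (hs : ∀ i ∈ I, s i ∈ E.sections) : (fun x => ∑ i ∈ I, s i x) ∈ E.sections := by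
  classical
  induction I using Finset.induction_on with
  | empty => simpa using hE.zero_mem
  | insert i I hi ih =>
    simp only [Finset.sum_insert hi]
    exact hE.add_mem (hs i (by simp)) (ih fun j hj => hs j (by simp [hj]))

theorem sub_mem (hE : E.IsMeasurableField) {s t : ∀ x, E.fiber x} (hs : s ∈ E.sections)
    (ht : t ∈ E.sections) : (fun x => s x - t x) ∈ E.sections := by
  have := hE.add_mem hs (hE.smul_mem ht (c := fun _ => -1) measurable_const)
  simpa [sub_eq_add_neg] using this

theorem measurable_norm (hE : E.IsMeasurableField) {s : ∀ x, E.fiber x} (hs : s ∈ E.sections) :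
    Measurable fun x => ‖s x‖ := by
  have h := Complex.measurable_re.comp (hE.measurable_inner s hs s hs)
  have h2 : (fun x => ‖s x‖) = fun x => Real.sqrt (inner ℂ (s x) (s x)).re := by
    ext x
    rw [inner_self_eq_norm_sq_to_K]
    simp [← Complex.ofReal_pow, Complex.ofReal_re, Real.sqrt_sq (norm_nonneg _)]
  rw [h2]
  exact Real.continuous_sqrt.measurable.comp h

/-- The Gram–Schmidt process yields measurable sections which are an orthonormal frame in every
fibre. -/
theorem exists_isOrthoFrame (hE : E.IsMeasurableField) : ∃ e : ℕ → ∀ x, E.fiber x,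
    (∀ n, e n ∈ E.sections) ∧ ∀ x, IsOrthoFrame fun n => e n x := by
  obtain ⟨f, hf, hd⟩ := hE.exists_total
  have h : ∀ n, (fun x => InnerProductSpace.gramSchmidt ℂ (fun n => f n x) n) ∈ E.sections := by
    intro n
    induction n using Nat.strong_induction_on with
    | _ n ih =>
      rw [funext fun x => InnerProductSpace.gramSchmidt_def ℂ (fun n => f n x) n]
      simp only [Submodule.starProjection_singleton]
      refine hE.sub_mem (hf n) (hE.sum_mem _ fun i hi => ?_)
      have h1 := ih i (by simpa using hi)
      refine hE.smul_mem h1 ?_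
      exact (hE.measurable_inner _ h1 _ (hf n)).div
        (Complex.measurable_ofReal.comp ((hE.measurable_norm h1).pow_const 2))
  refine ⟨fun n x => InnerProductSpace.gramSchmidtNormed ℂ (fun n => f n x) n, fun n => ?_,
    fun x => isOrthoFrame_gramSchmidtNormed (hd x)⟩
  exact hE.smul_mem (h n) (Complex.measurable_ofReal.comp (hE.measurable_norm (h n))).inv

end ProductSystemData.IsMeasurableField

end Sections

section EssentialRep

/-- An essential representation of a product system `E` on a Hilbert space `H`: a weakly
measurable, multiplicative family of maps `E(x) → B(H)` with `φ(u)* φ(v) = ⟨u, v⟩ 1` such that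
`φ(E(x)) H` is total in `H` for every `x`. -/
structure EssentialRep {P : Type*} [Mul P] [MeasurableSpace P] (E : ProductSystemData P)
    (H : Type*) [NormedAddCommGroup H] [InnerProductSpace ℂ H] where
  op : ∀ x, E.fiber x →ₗ[ℂ] (H →L[ℂ] H)
  isTensorAction : ∀ x, IsTensorAction (op x)
  op_mul : ∀ (x y : P) (u : E.fiber x) (v : E.fiber y), op (x * y) (E.mul u v) = op x u * op y v
  measurable : ∀ s ∈ E.sections, ∀ ξ η : H, Measurable fun x => inner ℂ η (op x (s x) ξ)

namespace EssentialRep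

variable {P : Type*} [Mul P] [MeasurableSpace P] {E : ProductSystemData P}
  {H : Type*} [NormedAddCommGroup H] [InnerProductSpace ℂ H]

/-- The representation `u ↦ U φ(u) U⁻¹` obtained from a unitary `U : H → H'`. -/
def conj (ρ : EssentialRep E H) {H' : Type*} [NormedAddCommGroup H'] [InnerProductSpace ℂ H']
    (U : H ≃ₗᵢ[ℂ] H') : EssentialRep E H' where
  op x :=
    { toFun := fun u => (U : H →L[ℂ] H') ∘L ρ.op x u ∘L (U.symm : H' →L[ℂ] H)
      map_add' := fun u v => by ext; simp
      map_smul' := fun c u => by ext; simp }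
  isTensorAction x :=
    { inner_apply := fun u v ξ η => by
        have := (ρ.isTensorAction x).inner_apply u v (U.symm ξ) (U.symm η)
        rw [U.symm.inner_map_map] at this
        rw [← this]
        exact U.inner_map_map _ _
      dense := by
        have h := U.surjective.denseRange.dense_image U.continuous (ρ.isTensorAction x).dense
        refine h.mono ?_
        rintro _ ⟨ζ, hζ, rfl⟩
        have h2 := Submodule.mem_map_of_mem (f := (U.toLinearEquiv : H →ₗ[ℂ] H')) hζ
        rw [Submodule.map_span] at h2
        refine Submodule.span_mono ?_ h2
        rintro _ ⟨_, ⟨u, ξ, rfl⟩, rfl⟩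
        exact ⟨u, U ξ, by simp⟩ }
  op_mul x y u v := by
    ext ξ
    simp [ρ.op_mul]
  measurable s hs ξ η := by
    have h := ρ.measurable s hs (U.symm ξ) (U.symm η)
    convert! h using 2 with x
    rw [← U.symm.inner_map_map]
    simp

variable [CompleteSpace H]

open ContinuousLinearMap (adjoint)

/-- The amplification `α_x(A)`, determined by `α_x(A) φ(u) = φ(u) A` for `u ∈ E(x)`. -/
def amp (ρ : EssentialRep E H) (x : P) (A : H →L[ℂ] H) : H →L[ℂ] H :=
  ((ρ.isTensorAction x).exists_amplification A).choose

theorem amp_apply (ρ : EssentialRep E H) (x : P) (A : H →L[ℂ] H) (u : E.fiber x) (ξ : H) :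
    ρ.amp x A (ρ.op x u ξ) = ρ.op x u (A ξ) :=
  ((ρ.isTensorAction x).exists_amplification A).choose_spec u ξ

theorem amp_eq (ρ : EssentialRep E H) {x : P} {A T : H →L[ℂ] H}
    (h : ∀ u ξ, T (ρ.op x u ξ) = ρ.op x u (A ξ)) : ρ.amp x A = T :=
  (ρ.isTensorAction x).ext fun u ξ => by rw [amp_apply, h]

theorem amp_star (ρ : EssentialRep E H) (x : P) (A : H →L[ℂ] H) :
    ρ.amp x (star A) = star (ρ.amp x A) := by
  refine ρ.amp_eq fun u ξ => (ρ.isTensorAction x).ext_inner fun v η => ?_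
  rw [ContinuousLinearMap.star_eq_adjoint, ContinuousLinearMap.adjoint_inner_right, amp_apply,
    (ρ.isTensorAction x).inner_apply, (ρ.isTensorAction x).inner_apply,
    ContinuousLinearMap.star_eq_adjoint, ContinuousLinearMap.adjoint_inner_right]

/-- The amplification as a unital `*`-endomorphism of `B(H)`. -/
def ampHom (ρ : EssentialRep E H) (x : P) : (H →L[ℂ] H) →⋆ₐ[ℂ] (H →L[ℂ] H) where
  toFun := ρ.amp x
  map_one' := ρ.amp_eq fun u ξ => by simp
  map_mul' A B := ρ.amp_eq fun u ξ => by simp [amp_apply]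
  map_zero' := ρ.amp_eq fun u ξ => by simp
  map_add' A B := ρ.amp_eq fun u ξ => by simp [amp_apply]
  commutes' c := ρ.amp_eq fun u ξ => by simp [Algebra.algebraMap_eq_smul_one]
  map_star' A := ρ.amp_star x A

theorem adjoint_op_amp (ρ : EssentialRep E H) (x : P) (A : H →L[ℂ] H) (u : E.fiber x) (ξ : H) :
    adjoint (ρ.op x u) (ρ.amp x A ξ) = A (adjoint (ρ.op x u) ξ) := by
  refine ext_inner_left ℂ fun η => ?_
  have h := ρ.amp_star x A
  rw [ContinuousLinearMap.adjoint_inner_right, ← ContinuousLinearMap.adjoint_inner_left,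
    ← ContinuousLinearMap.star_eq_adjoint, ← h, amp_apply,
    ← ContinuousLinearMap.adjoint_inner_right, ContinuousLinearMap.star_eq_adjoint,
    ContinuousLinearMap.adjoint_inner_left]

open scoped ComplexOrder in
theorem isNormalMap_ampHom (ρ : EssentialRep E H) (x : P) : IsNormalMap (ρ.ampHom x) := by
  intro S A hne hdir hsa hA
  refine ⟨?_, fun B hB => ?_⟩
  · rintro _ ⟨T, hT, rfl⟩
    exact OrderHomClass.mono (ρ.ampHom x) (hA.1 hT)
  have hm := ρ.isTensorAction x
  have : Nonempty S := hne.to_subtype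
  have : IsDirected S (· ≤ ·) := ⟨fun a b => by
    obtain ⟨c, hc, h1, h2⟩ := hdir a a.2 b b.2
    exact ⟨⟨c, hc⟩, h1, h2⟩⟩
  have : (atTop : Filter S).NeBot := atTop_neBot
  set D := Submodule.span ℂ {ζ | ∃ u ξ, ρ.op x u ξ = ζ}
  -- weak convergence of the amplifications on the dense subspace spanned by the `φ(u) ξ`
  have hlim : ∀ ζ ∈ D, ∀ ζ' ∈ D, Tendsto (fun T : S => inner ℂ (ρ.ampHom x T ζ) ζ') atTop
      (𝓝 (inner ℂ (ρ.ampHom x A ζ) ζ')) := by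
    intro ζ hζ ζ' hζ'
    induction hζ using Submodule.span_induction with
    | zero => simp
    | add a b _ _ ha hb => simpa [inner_add_left] using ha.add hb
    | smul c a _ ha => simpa [inner_smul_left, mul_comm] using ha.const_mul (starRingEnd ℂ c)
    | mem ζ hζ =>
      obtain ⟨u, ξ, rfl⟩ := hζ
      induction hζ' using Submodule.span_induction with
      | zero => simp
      | add a b _ _ ha hb => simpa [inner_add_right] using ha.add hb
      | smul c a _ ha => simpa [inner_smul_right] using ha.const_mul c
      | mem ζ' hζ' =>
        obtain ⟨v, η, rfl⟩ := hζ'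
        change Tendsto (fun T : S => inner ℂ (ρ.amp x T (ρ.op x u ξ)) (ρ.op x v η)) _
          (𝓝 (inner ℂ (ρ.amp x A (ρ.op x u ξ)) (ρ.op x v η)))
        simp only [amp_apply, hm.inner_apply]
        exact (tendsto_inner_of_isLUB hne hdir hsa hA ξ η).const_mul _
  have hpos : ∀ ζ, 0 ≤ inner ℂ ((B - ρ.ampHom x A) ζ) ζ := by
    intro ζ
    refine closure_minimal (s := (D : Set H)) (t := {ζ | 0 ≤ inner ℂ ((B - ρ.ampHom x A) ζ) ζ})
      (fun ζ hζ => ?_) (isClosed_le continuous_const (by fun_prop)) (hm.dense ζ)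
    change 0 ≤ inner ℂ ((B - ρ.ampHom x A) ζ) ζ
    rw [sub_apply, inner_sub_left]
    refine ge_of_tendsto' (tendsto_const_nhds.sub (hlim ζ hζ ζ hζ)) fun T => ?_
    have := ((ContinuousLinearMap.le_def _ _).mp (hB ⟨T, T.2, rfl⟩)).inner_nonneg_left ζ
    rwa [sub_apply, inner_sub_left] at this
  rw [ContinuousLinearMap.le_def, ContinuousLinearMap.isPositive_iff_complex]
  intro ζ
  have h := Complex.le_def.mp (hpos ζ)
  exact ⟨Complex.ext rfl h.2, h.1⟩

/-- Every operator intertwining the identity and `α_x` is of the form `φ(v)` with `v ∈ E(x)`. -/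
theorem exists_op_eq (ρ : EssentialRep E H) (x : P) [CompleteSpace (E.fiber x)] [Nontrivial H]
    (T : H →L[ℂ] H) (hT : ∀ A, ρ.amp x A * T = T * A) : ∃ v, ρ.op x v = T := by
  have h1 : ∀ u, ∃ c : ℂ, adjoint (ρ.op x u) ∘L T = c • 1 := by
    intro u
    obtain ⟨c, hc, -⟩ := exists_scalar_of_commute (adjoint (ρ.op x u) ∘L T) fun A => by
      ext ξ
      have := congrArg (fun B : H →L[ℂ] H => B ξ) (hT A)
      simp only [mul_apply_eq_comp] at this
      simp only [mul_apply_eq_comp, ContinuousLinearMap.comp_apply, ← this,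
        adjoint_op_amp]
    exact ⟨c, hc⟩
  choose c hc using h1
  have hc' : ∀ u ξ, adjoint (ρ.op x u) (T ξ) = c u • ξ := fun u ξ => by
    simpa using congrArg (fun B : H →L[ℂ] H => B ξ) (hc u)
  obtain ⟨ξ₀, hξ₀⟩ := exists_norm_eq (E := H) zero_le_one
  have hcu : ∀ u, c u = inner ℂ (ρ.op x u ξ₀) (T ξ₀) := fun u => by
    rw [← ContinuousLinearMap.adjoint_inner_right, hc', inner_smul_right,
      inner_self_eq_norm_sq_to_K, hξ₀]
    simp
  -- `c` is conjugate linear and bounded, hence given by a vector `v`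
  let f : E.fiber x →L[ℂ] ℂ := LinearMap.mkContinuous
    { toFun := fun u => starRingEnd ℂ (c u)
      map_add' := fun u v => by simp only [hcu, map_add, add_apply, inner_add_left]
      map_smul' := fun a u => by
        simp only [hcu, map_smul, smul_apply, inner_smul_left, map_mul, Complex.conj_conj]
        rfl } ‖T ξ₀‖ fun u => by
      change ‖starRingEnd ℂ (c u)‖ ≤ _
      rw [RCLike.norm_conj, hcu]
      refine (norm_inner_le_norm _ _).trans_eq ?_
      rw [(ρ.isTensorAction x).norm_apply, hξ₀, mul_one, mul_comm]
  refine ⟨(InnerProductSpace.toDual ℂ (E.fiber x)).symm f, ?_⟩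
  ext ξ
  refine (ρ.isTensorAction x).ext_inner fun u η => ?_
  have h2 : inner ℂ u ((InnerProductSpace.toDual ℂ (E.fiber x)).symm f) = c u := by
    rw [← inner_conj_symm, InnerProductSpace.toDual_symm_apply]
    exact Complex.conj_conj _
  rw [(ρ.isTensorAction x).inner_apply, h2, ← ContinuousLinearMap.adjoint_inner_right (ρ.op x u),
    hc', inner_smul_right]

variable [TopologicalSpace.SeparableSpace H]

theorem measurable_amp (ρ : EssentialRep E H) (hE : E.IsMeasurableField) (A : H →L[ℂ] H)
    (ξ η : H) : Measurable fun x => inner ℂ η (ρ.amp x A ξ) := by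
  obtain ⟨e, he, hfr⟩ := hE.exists_isOrthoFrame
  have hsm : ∀ n (ζ : H), MeasureTheory.StronglyMeasurable
      fun x => adjoint (ρ.op x (e n x)) ζ := by
    intro n ζ
    refine stronglyMeasurable_of_inner fun η => ?_
    simp only [ContinuousLinearMap.adjoint_inner_right]
    have := Complex.continuous_conj.measurable.comp (ρ.measurable (e n) (he n) η ζ)
    simpa [Function.comp_def] using this
  refine measurable_of_tendsto_metrizable (f := fun k x => ∑ n ∈ Finset.range k,
    inner ℂ (adjoint (ρ.op x (e n x)) η) (adjoint (ρ.op x (e n x)) (ρ.amp x A ξ)))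
    (fun k => ?_) (tendsto_pi_nhds.mpr fun x =>
      tendsto_sum_inner_adjoint (ρ.isTensorAction x) (hfr x) _ _)
  refine Finset.measurable_fun_sum _ fun n _ => ?_
  simp only [adjoint_op_amp]
  exact ((hsm n η).inner (A.continuous.comp_stronglyMeasurable (hsm n ξ))).measurable

/-- The `E₀`-semigroup of amplifications. -/
def e0Semigroup (ρ : EssentialRep E H) (hE : E.IsMeasurableField) :
    E0Semigroup P H where
  toHom := ρ.ampHom
  map_mul x y A := by
    refine ((ρ.amp_eq fun u ζ => ?_ : ρ.amp x (ρ.amp y A) = ρ.amp (x * y) A)).symm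
    have h : ρ.amp (x * y) A ∘L ρ.op x u = ρ.op x u ∘L ρ.amp y A :=
      (ρ.isTensorAction y).ext fun v ξ => by
        have h1 : ρ.op x u (ρ.op y v ξ) = ρ.op (x * y) (E.mul u v) ξ := by rw [ρ.op_mul]; rfl
        rw [ContinuousLinearMap.comp_apply, ContinuousLinearMap.comp_apply, h1, amp_apply,
          amp_apply, ρ.op_mul]
        rfl
    exact congrArg (fun B : H →L[ℂ] H => B ζ) h
  normal := ρ.isNormalMap_ampHom
  measurable A ξ η := ρ.measurable_amp hE A ξ η

/-- The unitary `E(x) → E_α(x)` given by an essential representation. -/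
theorem exists_unitary_productSystem (ρ : EssentialRep E H) (hE : E.IsMeasurableField)
    [Nontrivial H] (x : P) [CompleteSpace (E.fiber x)] :
    ∃ θ : E.fiber x ≃ₗᵢ[ℂ] (ρ.e0Semigroup hE).productSystem.fiber x,
      ∀ u, (θ u : (ρ.e0Semigroup hE).intertwiner x).1 = ρ.op x u := by
  set α := ρ.e0Semigroup hE
  have hmem : ∀ u, ρ.op x u ∈ α.intertwiner x := fun u A => by
    ext ξ
    exact ρ.amp_apply x A u ξ
  let f : E.fiber x →ₗ[ℂ] α.intertwiner x := (ρ.op x).codRestrict _ hmem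
  have hf : ∀ u v, inner ℂ (f u) (f v) = inner ℂ u v := fun u v => by
    refine α.scalar_eq x (f v) (f u) _ ?_ fun h => absurd h (not_subsingleton H)
    ext ξ
    exact (ρ.isTensorAction x).adjoint_apply u v ξ
  have hs : Function.Surjective (f.isometryOfInner hf) := fun T => by
    obtain ⟨v, hv⟩ := ρ.exists_op_eq x T.1 T.2
    exact ⟨v, Subtype.ext hv⟩
  exact ⟨LinearIsometryEquiv.ofSurjective (f.isometryOfInner hf) hs, fun u => rfl⟩

/-- A product system with an essential representation on a separable space is concrete. -/
theorem isConcrete_of_type_zero {H : Type} [NormedAddCommGroup H] [InnerProductSpace ℂ H]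
    [CompleteSpace H] [TopologicalSpace.SeparableSpace H] [Nontrivial H]
    (ρ : EssentialRep E H) (hE : E.IsMeasurableField) (hc : ∀ x, CompleteSpace (E.fiber x)) :
    E.IsConcrete := by
  choose θ hθ using fun x => ρ.exists_unitary_productSystem hE x
  refine ⟨H, _, _, ‹_›, ‹_›, ρ.e0Semigroup hE, θ, fun x y u v => ?_, fun s hs ξ η => ?_⟩
  · refine Subtype.ext ?_
    change ((θ (x * y) (E.mul u v) : (ρ.e0Semigroup hE).intertwiner (x * y))).1 =
      ((θ x u : (ρ.e0Semigroup hE).intertwiner x)).1 *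
        ((θ y v : (ρ.e0Semigroup hE).intertwiner y)).1
    rw [hθ, hθ, hθ, ρ.op_mul]
  · simp only [hθ]
    exact ρ.measurable s hs ξ η

/-- Every separable Hilbert space is isometric to one in the universe `Type`, namely to `ℓ²` over
the set of nonvanishing members of an orthonormal frame. -/
theorem isConcrete [Nontrivial H] (ρ : EssentialRep E H) (hE : E.IsMeasurableField)
    (hc : ∀ x, CompleteSpace (E.fiber x)) : E.IsConcrete := by
  obtain ⟨e, he⟩ := _root_.exists_isOrthoFrame H
  have ho : Orthonormal ℂ fun n : {n // e n ≠ 0} => e n :=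
    ⟨fun n => (he.norm_eq n).resolve_left n.2,
      fun i j hij => he.orthogonal fun h => hij (Subtype.ext h)⟩
  have hspan : Submodule.span ℂ (Set.range e) ≤
      Submodule.span ℂ (Set.range fun n : {n // e n ≠ 0} => e n) := by
    rw [Submodule.span_le]
    rintro _ ⟨n, rfl⟩
    by_cases h : e n = 0
    · rw [h]; exact Submodule.zero_mem _
    · exact Submodule.subset_span ⟨⟨n, h⟩, rfl⟩
  let b : HilbertBasis {n // e n ≠ 0} ℂ H := HilbertBasis.mk ho
    ((Submodule.dense_iff_topologicalClosure_eq_top.mp (he.dense.mono hspan)).ge)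
  have : TopologicalSpace.SeparableSpace (lp (fun _ : {n // e n ≠ 0} => ℂ) 2) :=
    b.repr.surjective.denseRange.separableSpace b.repr.continuous
  have : Nontrivial (lp (fun _ : {n // e n ≠ 0} => ℂ) 2) := b.repr.toEquiv.symm.nontrivial
  exact (ρ.conj b.repr).isConcrete_of_type_zero hE hc

end EssentialRep

end EssentialRep

/-! ### Multiplication on sections -/

section Fibres

open ContinuousLinearMap (adjoint)

namespace ProductSystemData

variable {P : Type*} [Mul P] {E : ProductSystemData P}

theorem apply_eq_of_sigma_eq {f : ∀ z, E.fiber z} {z z' : P} {a : E.fiber z} {b : E.fiber z'}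
    (hb : f z' = b) (h : (⟨z', b⟩ : Σ z, E.fiber z) = ⟨z, a⟩) : f z = a := by
  obtain ⟨rfl, h⟩ := Sigma.mk.inj_iff.mp h
  rw [hb]
  exact eq_of_heq h

theorem inner_eq_of_sigma_eq {z z' : P} {a b : E.fiber z} {a' b' : E.fiber z'}
    (ha : (⟨z, a⟩ : Σ z, E.fiber z) = ⟨z', a'⟩) (hb : (⟨z, b⟩ : Σ z, E.fiber z) = ⟨z', b'⟩) :
    inner ℂ a b = inner ℂ a' b' := by
  obtain ⟨rfl, h⟩ := Sigma.mk.inj_iff.mp ha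
  obtain ⟨_, h'⟩ := Sigma.mk.inj_iff.mp hb
  rw [eq_of_heq h, eq_of_heq h']

theorem sigma_apply_eq (f : ∀ z, E.fiber z) {z z' : P} (h : z = z') :
    (⟨z, f z⟩ : Σ z, E.fiber z) = ⟨z', f z'⟩ := by rw [h]

section Push

open Classical in
/-- The section carried by the range of `j` whose value at `j y` is `f y`, extended by zero. -/
def push (j : P → P) (f : ∀ y, E.fiber (j y)) (z : P) : E.fiber z :=
  if h : ∃ y, j y = z then h.choose_spec ▸ f h.choose else 0

theorem push_apply {j : P → P} (hj : Function.Injective j) (f : ∀ y, E.fiber (j y)) (y : P) :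
    push j f (j y) = f y := by
  have h : ∃ y', j y' = j y := ⟨y, rfl⟩
  rw [push, dif_pos h]
  have h2 : ∀ (y' : P) (h' : j y' = j y), h' ▸ f y' = f y := by
    intro y' h'
    obtain rfl := hj h'
    rfl
  exact h2 _ h.choose_spec

theorem push_of_notMem {j : P → P} (f : ∀ y, E.fiber (j y)) {z : P} (hz : z ∉ Set.range j) :
    push j f z = 0 := dif_neg hz

theorem push_mem [MeasurableSpace P] (hE : E.IsMeasurableField) {j : P → P}
    (hj : MeasurableEmbedding j) (f : ∀ y, E.fiber (j y))
    (hf : ∀ t ∈ E.sections, Measurable fun y => inner ℂ (t (j y)) (f y)) :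
    push j f ∈ E.sections := by
  refine hE.mem_of_measurable_inner _ fun t ht => ?_
  have h : (fun z => inner ℂ (t z) (push j f z)) =
      Function.extend j (fun y => inner ℂ (t (j y)) (f y)) (fun _ => 0) := by
    ext z
    by_cases hz : z ∈ Set.range j
    · obtain ⟨y, rfl⟩ := hz
      rw [hj.injective.extend_apply, push_apply hj.injective]
    · rw [Function.extend_apply' _ _ _ hz, push_of_notMem f hz, inner_zero_right]
  rw [h]
  exact hj.measurable_extend (hf t ht) measurable_const

end Push

variable [MeasurableSpace P] (hE : E.IsProductSystem)
include hE

namespace IsProductSystem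

/-- The product of `E`, as a linear map from `E(x)` to the operators `E(y) → E(xy)`. -/
theorem exists_mulOp (x y : P) : ∃ m : E.fiber x →ₗ[ℂ] (E.fiber y →L[ℂ] E.fiber (x * y)),
    IsTensorAction m ∧ ∀ u v, m u v = E.mul u v := by
  obtain ⟨U, hU⟩ := hE.exists_unitary x y
  let m : E.fiber x →ₗ[ℂ] (E.fiber y →L[ℂ] E.fiber (x * y)) :=
    { toFun := fun u => LinearMap.mkContinuous
        { toFun := fun v => U ((u ⊗ₜ[ℂ] v : E.fiber x ⊗[ℂ] E.fiber y) :
            UniformSpace.Completion (E.fiber x ⊗[ℂ] E.fiber y))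
          map_add' := fun v w => by
            rw [TensorProduct.tmul_add, UniformSpace.Completion.coe_add, map_add]
          map_smul' := fun c v => by
            rw [TensorProduct.tmul_smul, UniformSpace.Completion.coe_smul, map_smul]; rfl } ‖u‖
        fun v => by
          change ‖U _‖ ≤ _
          rw [U.norm_map, UniformSpace.Completion.norm_coe, TensorProduct.norm_tmul]
      map_add' := fun u w => by
        ext v
        change U _ = U _ + U _
        rw [TensorProduct.add_tmul, UniformSpace.Completion.coe_add, map_add]
      map_smul' := fun c u => by
        ext v
        change U _ = c • U _
        rw [← TensorProduct.smul_tmul', UniformSpace.Completion.coe_smul, map_smul] }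
  have hm : ∀ u v, m u v = U ((u ⊗ₜ[ℂ] v : E.fiber x ⊗[ℂ] E.fiber y) :
            UniformSpace.Completion (E.fiber x ⊗[ℂ] E.fiber y)) := fun u v => rfl
  refine ⟨m, ⟨fun u v ξ η => ?_, ?_⟩, fun u v => by rw [hm, hU]⟩
  · rw [hm, hm, U.inner_map_map, UniformSpace.Completion.inner_coe, TensorProduct.inner_tmul]
  · have hd : DenseRange fun t : E.fiber x ⊗[ℂ] E.fiber y =>
        U (t : UniformSpace.Completion (E.fiber x ⊗[ℂ] E.fiber y)) :=
      U.surjective.denseRange.comp UniformSpace.Completion.denseRange_coe U.continuous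
    refine hd.mono ?_
    rintro _ ⟨t, rfl⟩
    change _ ∈ Submodule.span ℂ _
    induction t with
    | zero =>
      beta_reduce
      rw [UniformSpace.Completion.coe_zero, map_zero]
      exact Submodule.zero_mem _
    | tmul u v => exact Submodule.subset_span ⟨u, v, rfl⟩
    | add a b ha hb =>
      simp only [UniformSpace.Completion.coe_add, map_add]
      exact Submodule.add_mem _ ha hb

/-- Left multiplication by `u ∈ E(x)`, as an operator `E(y) → E(xy)`. -/
def mulOp (x y : P) : E.fiber x →ₗ[ℂ] (E.fiber y →L[ℂ] E.fiber (x * y)) :=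
  (hE.exists_mulOp x y).choose

theorem isTensorAction_mulOp (x y : P) : IsTensorAction (hE.mulOp x y) :=
  (hE.exists_mulOp x y).choose_spec.1

theorem mulOp_apply {x y : P} (u : E.fiber x) (v : E.fiber y) : hE.mulOp x y u v = E.mul u v :=
  (hE.exists_mulOp x y).choose_spec.2 u v

theorem inner_mul {x y : P} (u u' : E.fiber x) (v v' : E.fiber y) :
    inner ℂ (E.mul u v) (E.mul u' v') = inner ℂ u u' * inner ℂ v v' := by
  simp only [← hE.mulOp_apply]
  exact (hE.isTensorAction_mulOp x y).inner_apply u u' v v'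

theorem mul_add {x y : P} (u : E.fiber x) (v w : E.fiber y) :
    E.mul u (v + w) = E.mul u v + E.mul u w := by simp only [← hE.mulOp_apply, map_add]

theorem add_mul {x y : P} (u w : E.fiber x) (v : E.fiber y) :
    E.mul (u + w) v = E.mul u v + E.mul w v := by
  simp only [← hE.mulOp_apply, map_add, add_apply]

theorem mul_smul {x y : P} (c : ℂ) (u : E.fiber x) (v : E.fiber y) :
    E.mul u (c • v) = c • E.mul u v := by simp only [← hE.mulOp_apply, map_smul]

theorem smul_mul {x y : P} (c : ℂ) (u : E.fiber x) (v : E.fiber y) :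
    E.mul (c • u) v = c • E.mul u v := by
  simp only [← hE.mulOp_apply, map_smul, smul_apply]

theorem mul_zero {x y : P} (u : E.fiber x) : E.mul u (0 : E.fiber y) = 0 := by
  rw [← hE.mulOp_apply, map_zero]

theorem zero_mul {x y : P} (v : E.fiber y) : E.mul (0 : E.fiber x) v = 0 := by
  rw [← hE.mulOp_apply, map_zero, zero_apply]

open Classical in
/-- Every vector is the value of a measurable section. -/
theorem exists_section_eq [MeasurableSingletonClass P] {x : P} (u : E.fiber x) :
    ∃ s ∈ E.sections, s x = u := by
  refine ⟨Function.update (fun _ => 0) x u, ?_, by simp⟩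
  refine hE.measurableField.mem_of_measurable_inner _ fun t ht => ?_
  have : (fun z => inner ℂ (t z) (Function.update (fun _ => 0 : ∀ z, E.fiber z) x u z)) =
      fun z => if z = x then inner ℂ (t x) u else 0 := by
    ext z
    by_cases hz : z = x
    · subst hz; simp
    · simp [hz]
  rw [this]
  exact Measurable.ite (measurableSet_singleton x) measurable_const measurable_const

theorem measurable_inner_mul_left [MeasurableSingletonClass P] {x : P} (u : E.fiber x)
    {f t : ∀ y, E.fiber y} (hf : f ∈ E.sections) (ht : t ∈ E.sections) :
    Measurable fun y => inner ℂ (t (x * y)) (E.mul u (f y)) := by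
  obtain ⟨s, hs, rfl⟩ := hE.exists_section_eq u
  exact (hE.measurable_mul s hs f hf t ht).comp (measurable_const.prodMk measurable_id)

theorem measurable_inner_mul_right [MeasurableSingletonClass P] {r : P} (e : E.fiber r)
    {f t : ∀ y, E.fiber y} (hf : f ∈ E.sections) (ht : t ∈ E.sections) :
    Measurable fun y => inner ℂ (t (y * r)) (E.mul (f y) e) := by
  obtain ⟨s, hs, rfl⟩ := hE.exists_section_eq e
  exact (hE.measurable_mul f hf s hs t ht).comp (measurable_id.prodMk measurable_const)

end IsProductSystem

omit hE

/-- Left multiplication by `u ∈ E(x)` on sections: `(uf)(xy) = u f(y)`, zero off `xP`. -/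
def lmul {x : P} (u : E.fiber x) (f : ∀ y, E.fiber y) : ∀ z, E.fiber z :=
  push (x * ·) fun y => E.mul u (f y)

/-- Right multiplication by `e ∈ E(r)` on sections: `(fe)(yr) = f(y)e`, zero off `Pr`. -/
def rmul {r : P} (e : E.fiber r) (f : ∀ y, E.fiber y) : ∀ z, E.fiber z :=
  push (· * r) fun y => E.mul (f y) e

/-- The adjoint of left multiplication on sections: `(u*f)(y) = u* f(xy)`. -/
def lmulAdj (hE : E.IsProductSystem) {x : P} (u : E.fiber x) (f : ∀ y, E.fiber y) :
    ∀ y, E.fiber y :=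
  haveI := hE.complete
  fun y => adjoint (hE.mulOp x y u) (f (x * y))

end ProductSystemData

end Fibres

/-! ### Multiplication on sections over a subsemigroup of a group -/

section Sections

open ContinuousLinearMap (adjoint)

variable {G : Type*} [Group G] {P : Subsemigroup G}

theorem Subsemigroup.mul_left_injective_coe (x : P) : Function.Injective (x * · : P → P) :=
  fun _ _ h => Subtype.ext (mul_left_cancel (congrArg Subtype.val h))

theorem Subsemigroup.mul_right_injective_coe (r : P) : Function.Injective (· * r : P → P) :=
  fun _ _ h => Subtype.ext (mul_right_cancel (congrArg Subtype.val h))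

section Measurable

variable [TopologicalSpace G] [IsTopologicalGroup G] [MeasurableSpace G] [BorelSpace G]

theorem MeasurableEmbedding.of_subtype_comp {X Y : Type*} [MeasurableSpace X] [MeasurableSpace Y]
    {S : Set Y} {j : X → S} (h : MeasurableEmbedding fun x => (j x : Y)) :
    MeasurableEmbedding j where
  injective a b hab := h.injective (congrArg Subtype.val hab)
  measurable := h.measurable.subtype_mk
  measurableSet_image' A hA := by
    have h1 := measurable_subtype_coe (p := (· ∈ S)) (h.measurableSet_image' hA)
    convert! h1 using 1
    ext y
    constructor
    · rintro ⟨a, ha, rfl⟩; exact ⟨a, ha, rfl⟩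
    · rintro ⟨a, ha, hy⟩; exact ⟨a, ha, Subtype.ext hy⟩

theorem Subsemigroup.measurableEmbedding_mul_left (hP : MeasurableSet (P : Set G)) (x : P) :
    MeasurableEmbedding (x * · : P → P) :=
  .of_subtype_comp (S := (P : Set G)) ((Homeomorph.mulLeft (x : G)).measurableEmbedding.comp
    (MeasurableEmbedding.subtype_coe hP))

theorem Subsemigroup.measurableEmbedding_mul_right (hP : MeasurableSet (P : Set G)) (r : P) :
    MeasurableEmbedding (· * r : P → P) :=
  .of_subtype_comp (S := (P : Set G)) ((Homeomorph.mulRight (r : G)).measurableEmbedding.comp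
    (MeasurableEmbedding.subtype_coe hP))

end Measurable

namespace ProductSystemData

variable {E : ProductSystemData P}

theorem lmul_apply {x : P} (u : E.fiber x) (f : ∀ y, E.fiber y) (y : P) :
    lmul u f (x * y) = E.mul u (f y) :=
  push_apply (Subsemigroup.mul_left_injective_coe x) _ y

theorem lmul_of_notMem {x : P} (u : E.fiber x) (f : ∀ y, E.fiber y) {z : P}
    (hz : ∀ y, x * y ≠ z) : lmul u f z = 0 :=
  push_of_notMem (j := (x * · : P → P)) _ fun ⟨y, hy⟩ => hz y hy

theorem rmul_apply {r : P} (e : E.fiber r) (f : ∀ y, E.fiber y) (y : P) :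
    rmul e f (y * r) = E.mul (f y) e :=
  push_apply (Subsemigroup.mul_right_injective_coe r) (fun y => E.mul (f y) e) y

theorem rmul_of_notMem {r : P} (e : E.fiber r) (f : ∀ y, E.fiber y) {z : P}
    (hz : ∀ y, y * r ≠ z) : rmul e f z = 0 :=
  push_of_notMem (j := (· * r : P → P)) _ fun ⟨y, hy⟩ => hz y hy

section Algebra

variable [MeasurableSpace G] (hE : E.IsProductSystem)
include hE

theorem lmul_add {x : P} (u : E.fiber x) (f f' : ∀ y, E.fiber y) :
    lmul u (f + f') = lmul u f + lmul u f' := by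
  funext z
  by_cases hz : ∃ y, x * y = z
  · obtain ⟨y, rfl⟩ := hz
    simp only [Pi.add_apply, lmul_apply, hE.mul_add]
  · push Not at hz
    simp [lmul_of_notMem _ _ hz]

theorem lmul_smul {x : P} (u : E.fiber x) (c : ℂ) (f : ∀ y, E.fiber y) :
    lmul u (c • f) = c • lmul u f := by
  funext z
  by_cases hz : ∃ y, x * y = z
  · obtain ⟨y, rfl⟩ := hz
    simp only [Pi.smul_apply, lmul_apply, hE.mul_smul]
  · push Not at hz
    simp [lmul_of_notMem _ _ hz]

theorem add_lmul {x : P} (u v : E.fiber x) (f : ∀ y, E.fiber y) :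
    lmul (u + v) f = lmul u f + lmul v f := by
  funext z
  by_cases hz : ∃ y, x * y = z
  · obtain ⟨y, rfl⟩ := hz
    simp only [Pi.add_apply, lmul_apply, hE.add_mul]
  · push Not at hz
    simp [lmul_of_notMem _ _ hz]

theorem smul_lmul {x : P} (c : ℂ) (u : E.fiber x) (f : ∀ y, E.fiber y) :
    lmul (c • u) f = c • lmul u f := by
  funext z
  by_cases hz : ∃ y, x * y = z
  · obtain ⟨y, rfl⟩ := hz
    simp only [Pi.smul_apply, lmul_apply, hE.smul_mul]
  · push Not at hz
    simp [lmul_of_notMem _ _ hz]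

theorem rmul_add {r : P} (e : E.fiber r) (f f' : ∀ y, E.fiber y) :
    rmul e (f + f') = rmul e f + rmul e f' := by
  funext z
  by_cases hz : ∃ y, y * r = z
  · obtain ⟨y, rfl⟩ := hz
    simp only [Pi.add_apply, rmul_apply, hE.add_mul]
  · push Not at hz
    simp [rmul_of_notMem _ _ hz]

theorem rmul_smul_fun {r : P} (e : E.fiber r) {c c' : P → ℂ} (hc : ∀ y, c' (y * r) = c y)
    (f : ∀ y, E.fiber y) :
    rmul e (fun y => c y • f y) = fun z => c' z • rmul e f z := by
  funext z
  by_cases hz : ∃ y, y * r = z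
  · obtain ⟨y, rfl⟩ := hz
    simp only [rmul_apply, hE.smul_mul, hc]
  · push Not at hz
    simp [rmul_of_notMem _ _ hz]

theorem rmul_smul {r : P} (e : E.fiber r) (c : ℂ) (f : ∀ y, E.fiber y) :
    rmul e (c • f) = c • rmul e f :=
  rmul_smul_fun hE e (c := fun _ => c) (c' := fun _ => c) (fun _ => rfl) f

theorem rmul_zero {r : P} (e : E.fiber r) : rmul e (0 : ∀ y, E.fiber y) = 0 := by
  simpa using rmul_smul hE e 0 0

theorem lmul_mul {x y : P} (u : E.fiber x) (v : E.fiber y) (f : ∀ y, E.fiber y) :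
    lmul (E.mul u v) f = lmul u (lmul v f) := by
  funext z
  by_cases hz : ∃ w, x * w = z
  · obtain ⟨w, rfl⟩ := hz
    rw [lmul_apply]
    by_cases hw : ∃ w', y * w' = w
    · obtain ⟨w', rfl⟩ := hw
      rw [lmul_apply]
      exact apply_eq_of_sigma_eq (lmul_apply _ f w') (hE.mul_assoc _ _ _ _ _ _)
    · push Not at hw
      rw [lmul_of_notMem v f hw, hE.mul_zero, lmul_of_notMem]
      intro w' h
      rw [mul_assoc] at h
      exact hw w' (Subsemigroup.mul_left_injective_coe x h)
  · push Not at hz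
    rw [lmul_of_notMem u _ hz, lmul_of_notMem]
    intro w' h
    rw [mul_assoc] at h
    exact hz _ h

theorem lmul_rmul {x r : P} (u : E.fiber x) (e : E.fiber r) (f : ∀ y, E.fiber y) :
    lmul u (rmul e f) = rmul e (lmul u f) := by
  funext z
  symm
  by_cases hz : ∃ w, x * w = z
  · obtain ⟨w, rfl⟩ := hz
    rw [lmul_apply]
    by_cases hw : ∃ y, y * r = w
    · obtain ⟨y, rfl⟩ := hw
      rw [rmul_apply]
      exact apply_eq_of_sigma_eq (by rw [rmul_apply, lmul_apply]) (hE.mul_assoc _ _ _ u (f y) e)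
    · push Not at hw
      rw [rmul_of_notMem e f hw, hE.mul_zero]
      by_cases h : ∃ y', y' * r = x * w
      · obtain ⟨y', h⟩ := h
        rw [← h, rmul_apply, lmul_of_notMem, hE.zero_mul]
        rintro y rfl
        rw [mul_assoc] at h
        exact hw y (Subsemigroup.mul_left_injective_coe x h)
      · push Not at h
        exact rmul_of_notMem _ _ h
  · push Not at hz
    rw [lmul_of_notMem u _ hz]
    by_cases hr : ∃ y, y * r = z
    · obtain ⟨y, rfl⟩ := hr
      rw [rmul_apply, lmul_of_notMem, hE.zero_mul]
      intro w h
      exact hz (w * r) (by rw [← h, mul_assoc])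
    · push Not at hr
      rw [rmul_of_notMem _ _ hr]

/-- On sections carried by `xP`, the operation `f ↦ u* f` commutes with right multiplication. -/
theorem lmulAdj_rmul {x r : P} (u : E.fiber x) (e : E.fiber r) (f : ∀ y, E.fiber y)
    (hf : ∀ z, (∀ y, x * y ≠ z) → f z = 0) :
    lmulAdj hE u (rmul e f) = rmul e (lmulAdj hE u f) := by
  have := hE.complete
  funext w
  by_cases hw : ∃ y, y * r = w
  · obtain ⟨y, rfl⟩ := hw
    rw [rmul_apply]
    refine (hE.isTensorAction_mulOp y r).ext_inner fun v v' => ?_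
    rw [hE.mulOp_apply, hE.inner_mul, lmulAdj, lmulAdj, ContinuousLinearMap.adjoint_inner_right,
      ContinuousLinearMap.adjoint_inner_right, hE.mulOp_apply, hE.mulOp_apply]
    rw [← hE.inner_mul, ← rmul_apply]
    exact inner_eq_of_sigma_eq (hE.mul_assoc _ _ _ _ _ _).symm
      (sigma_apply_eq _ (mul_assoc _ _ _).symm)
  · push Not at hw
    rw [rmul_of_notMem _ _ hw, lmulAdj]
    suffices h : rmul e f (x * w) = 0 by rw [h, map_zero]
    by_cases h : ∃ y', y' * r = x * w
    · obtain ⟨y', h⟩ := h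
      rw [← h, rmul_apply, hf, hE.zero_mul]
      rintro y rfl
      rw [mul_assoc] at h
      exact hw y (Subsemigroup.mul_left_injective_coe x h)
    · push Not at h
      exact rmul_of_notMem _ _ h

/-- Over the fibres `E(xy)` the partial sums of `∑ₙ eₙ eₙ*` act on sections by `frameProj`. -/
theorem sum_lmul_lmulAdj_apply {x : P} (e : ℕ → E.fiber x) (k : ℕ) (f : ∀ y, E.fiber y) (y : P) :
    haveI := hE.complete
    (∑ n ∈ Finset.range k, lmul (e n) (lmulAdj hE (e n) f)) (x * y) =
      frameProj (hE.mulOp x y) e k (f (x * y)) := by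
  have := hE.complete
  rw [Finset.sum_apply, frameProj]
  refine Finset.sum_congr rfl fun n _ => ?_
  rw [lmul_apply, ← hE.mulOp_apply, lmulAdj]

theorem lmulAdj_mem [MeasurableSingletonClass P] {x : P} (u : E.fiber x) {f : ∀ y, E.fiber y} (hf : f ∈ E.sections) :
    lmulAdj hE u f ∈ E.sections := by
  have := hE.complete
  refine hE.measurableField.mem_of_measurable_inner _ fun t ht => ?_
  simp only [lmulAdj, ContinuousLinearMap.adjoint_inner_right, hE.mulOp_apply]
  have := Complex.continuous_conj.measurable.comp (hE.measurable_inner_mul_left u ht hf)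
  simpa [Function.comp_def] using this

end Algebra

section Measurable

variable [TopologicalSpace G] [IsTopologicalGroup G] [MeasurableSpace G] [BorelSpace G] [T2Space G]
  (hP : MeasurableSet (P : Set G)) (hE : E.IsProductSystem)
include hP hE

theorem lmul_mem {x : P} (u : E.fiber x) {f : ∀ y, E.fiber y} (hf : f ∈ E.sections) :
    lmul u f ∈ E.sections :=
  push_mem hE.measurableField (Subsemigroup.measurableEmbedding_mul_left hP x) _ fun _ ht =>
    hE.measurable_inner_mul_left u hf ht

theorem rmul_mem {r : P} (e : E.fiber r) {f : ∀ y, E.fiber y} (hf : f ∈ E.sections) :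
    rmul e f ∈ E.sections :=
  push_mem hE.measurableField (Subsemigroup.measurableEmbedding_mul_right hP r) _ fun _ ht =>
    hE.measurable_inner_mul_right e hf ht

end Measurable

end ProductSystemData

end Sections

/-! ### Square integrable sections of the inductive limits -/

section LimitSpace

open MeasureTheory

variable {G : Type*} [Group G] {P : Subsemigroup G} {E : ProductSystemData P}

namespace ProductSystemData

section ShiftInner

open Classical in
/-- The function `g ↦ ⟨f(ga), f'(ga)⟩` on `G`, zero where `ga ∉ P`. -/
def shiftInner (a : P) (f f' : ∀ y, E.fiber y) (g : G) : ℂ :=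
  if h : g * a ∈ P then inner ℂ (f ⟨g * a, h⟩) (f' ⟨g * a, h⟩) else 0

theorem shiftInner_of_eq {a : P} (f f' : ∀ y, E.fiber y) {g : G} {y : P} (h : g * a = y) :
    shiftInner a f f' g = inner ℂ (f y) (f' y) := by
  obtain ⟨y, hy⟩ := y
  subst h
  exact dif_pos hy

theorem shiftInner_of_notMem {a : P} (f f' : ∀ y, E.fiber y) {g : G} (h : g * a ∉ P) :
    shiftInner a f f' g = 0 := dif_neg h

/-- To prove an identity about `shiftInner` at `g`, distinguish whether `ga ∈ P`. -/
theorem mem_cases (a : P) (g : G) : (∃ y : P, g * a = y) ∨ g * a ∉ P := by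
  by_cases h : g * a ∈ P
  · exact Or.inl ⟨⟨_, h⟩, rfl⟩
  · exact Or.inr h

theorem shiftInner_add_left (a : P) (f₁ f₂ f' : ∀ y, E.fiber y) (g : G) :
    shiftInner a (f₁ + f₂) f' g = shiftInner a f₁ f' g + shiftInner a f₂ f' g := by
  rcases mem_cases a g with ⟨y, h⟩ | h
  · simp only [shiftInner_of_eq _ _ h, Pi.add_apply, inner_add_left]
  · simp only [shiftInner_of_notMem _ _ h, add_zero]

theorem shiftInner_smul_left (a : P) (c : ℂ) (f f' : ∀ y, E.fiber y) (g : G) :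
    shiftInner a (c • f) f' g = starRingEnd ℂ c * shiftInner a f f' g := by
  rcases mem_cases a g with ⟨y, h⟩ | h
  · simp only [shiftInner_of_eq _ _ h, Pi.smul_apply, inner_smul_left]
  · simp only [shiftInner_of_notMem _ _ h, mul_zero]

theorem conj_shiftInner (a : P) (f f' : ∀ y, E.fiber y) (g : G) :
    starRingEnd ℂ (shiftInner a f' f g) = shiftInner a f f' g := by
  rcases mem_cases a g with ⟨y, h⟩ | h
  · simp only [shiftInner_of_eq _ _ h, inner_conj_symm]
  · simp only [shiftInner_of_notMem _ _ h, map_zero]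

theorem shiftInner_self_nonneg (a : P) (f : ∀ y, E.fiber y) (g : G) :
    0 ≤ (shiftInner a f f g).re := by
  rcases mem_cases a g with ⟨y, h⟩ | h
  · rw [shiftInner_of_eq _ _ h]; exact inner_self_nonneg (𝕜 := ℂ)
  · rw [shiftInner_of_notMem _ _ h]; rfl

theorem norm_shiftInner_self (a : P) (f : ∀ y, E.fiber y) (g : G) :
    ‖shiftInner a f f g‖ = (shiftInner a f f g).re := by
  rcases mem_cases a g with ⟨y, h⟩ | h
  · rw [shiftInner_of_eq _ _ h, inner_self_eq_norm_sq_to_K]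
    simp [← Complex.ofReal_pow]
  · rw [shiftInner_of_notMem _ _ h]; simp

theorem norm_shiftInner_le (a : P) (f f' : ∀ y, E.fiber y) (g : G) :
    ‖shiftInner a f f' g‖ ≤ ‖shiftInner a f f g‖ + ‖shiftInner a f' f' g‖ := by
  rcases mem_cases a g with ⟨y, h⟩ | h
  · rw [shiftInner_of_eq _ _ h, shiftInner_of_eq _ _ h, shiftInner_of_eq _ _ h,
      inner_self_eq_norm_sq_to_K, inner_self_eq_norm_sq_to_K]
    simp only [norm_pow, RCLike.norm_ofReal, abs_norm]
    nlinarith [norm_inner_le_norm (𝕜 := ℂ) (f y) (f' y), sq_nonneg (‖f y‖ - ‖f' y‖),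
      sq_nonneg ‖f y‖, sq_nonneg ‖f' y‖]
  · simp [shiftInner_of_notMem _ _ h]

theorem norm_shiftInner_add_self_le (a : P) (f f' : ∀ y, E.fiber y) (g : G) :
    ‖shiftInner a (f + f') (f + f') g‖ ≤
      2 * ‖shiftInner a f f g‖ + 2 * ‖shiftInner a f' f' g‖ := by
  rcases mem_cases a g with ⟨y, h⟩ | h
  · rw [shiftInner_of_eq _ _ h, shiftInner_of_eq _ _ h, shiftInner_of_eq _ _ h,
      inner_self_eq_norm_sq_to_K, inner_self_eq_norm_sq_to_K, inner_self_eq_norm_sq_to_K]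
    simp only [norm_pow, RCLike.norm_ofReal, abs_norm, Pi.add_apply]
    nlinarith [norm_add_le (f y) (f' y), sq_nonneg (‖f y‖ - ‖f' y‖), norm_nonneg (f y + f' y)]
  · simp [shiftInner_of_notMem _ _ h]

theorem shiftInner_smul_fun (a : P) (c : P → ℂ) (d : ℂ)
    (f : ∀ y, E.fiber y) (g : G)
    (hd : ∀ y : P, g * a = y → d = starRingEnd ℂ (c y) * c y) :
    shiftInner a (fun y => c y • f y) (fun y => c y • f y) g = d * shiftInner a f f g := by
  rcases mem_cases a g with ⟨y, h⟩ | h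
  · rw [shiftInner_of_eq _ _ h, shiftInner_of_eq _ _ h, inner_smul_left, inner_smul_right,
      hd y h, mul_assoc]
  · simp only [shiftInner_of_notMem _ _ h, mul_zero]

section Mul

variable [MeasurableSpace G] (hE : E.IsProductSystem)
include hE

theorem shiftInner_rmul (a : P) {r : P} {e : E.fiber r} (he : ‖e‖ = 1) (f f' : ∀ y, E.fiber y) :
    shiftInner (a * r) (rmul e f) (rmul e f') = shiftInner a f f' := by
  funext g
  rcases mem_cases a g with ⟨y, h⟩ | h
  · have h' : g * (a * r : P) = (y * r : P) := by
      rw [MulMemClass.coe_mul, MulMemClass.coe_mul, ← mul_assoc, h]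
    rw [shiftInner_of_eq _ _ h, shiftInner_of_eq _ _ h', rmul_apply, rmul_apply, hE.inner_mul,
      inner_self_eq_norm_sq_to_K, he]
    simp
  · rw [shiftInner_of_notMem _ _ h]
    rcases mem_cases (a * r) g with ⟨z, hz⟩ | hz
    · rw [shiftInner_of_eq _ _ hz, rmul_of_notMem, inner_zero_left]
      rintro y rfl
      rw [MulMemClass.coe_mul, MulMemClass.coe_mul, ← mul_assoc] at hz
      exact h (mul_right_cancel hz ▸ y.2)
    · exact shiftInner_of_notMem _ _ hz

theorem shiftInner_lmul (a : P) {x : P} (u v : E.fiber x) (f f' : ∀ y, E.fiber y) (g : G) :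
    shiftInner a (lmul u f) (lmul v f') (x * g) = inner ℂ u v * shiftInner a f f' g := by
  rcases mem_cases a g with ⟨y, h⟩ | h
  · have h' : x * g * a = (x * y : P) := by rw [mul_assoc, h]; rfl
    rw [shiftInner_of_eq _ _ h, shiftInner_of_eq _ _ h', lmul_apply, lmul_apply, hE.inner_mul]
  · rw [shiftInner_of_notMem _ _ h, mul_zero]
    rcases mem_cases a (x * g) with ⟨z, hz⟩ | hz
    · rw [shiftInner_of_eq _ _ hz, lmul_of_notMem, inner_zero_left]
      rintro y rfl
      rw [MulMemClass.coe_mul, mul_assoc] at hz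
      exact h (mul_left_cancel hz ▸ y.2)
    · exact shiftInner_of_notMem _ _ hz

variable [TopologicalSpace G] [IsTopologicalGroup G] [BorelSpace G]

theorem measurable_shiftInner (hP : MeasurableSet (P : Set G)) (a : P) {f f' : ∀ y, E.fiber y}
    (hf : f ∈ E.sections) (hf' : f' ∈ E.sections) : Measurable (shiftInner a f f') := by
  have h : shiftInner a f f' = Function.extend (Subtype.val : P → G)
      (fun y => inner ℂ (f y) (f' y)) (fun _ => 0) ∘ (· * (a : G)) := by
    funext g
    rcases mem_cases a g with ⟨y, h⟩ | h
    · rw [shiftInner_of_eq _ _ h, Function.comp_apply, h, Subtype.val_injective.extend_apply]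
    · rw [shiftInner_of_notMem _ _ h, Function.comp_apply, Function.extend_apply']
      rintro ⟨y, hy⟩
      exact h (hy ▸ y.2)
  rw [h]
  exact ((MeasurableEmbedding.subtype_coe hP).measurable_extend
    (hE.measurableField.measurable_inner f hf f' hf') measurable_const).comp
    (continuous_mul_const (a : G)).measurable

end Mul

end ShiftInner

end ProductSystemData

open ProductSystemData

/-- A sequence `q₀, q₁ = q₀ r₀, q₂ = q₁ r₁, …` in `P` such that `G` is the (increasing) union of
the sets `P qₙ⁻¹`, and unit vectors `eₙ ∈ E(rₙ)`. Right multiplication by `eₙ` embeds `E(g qₙ)` into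
`E(g qₙ₊₁)`, so that for every `g ∈ G` there is the inductive limit `K(g) = lim E(g qₙ)`. The laws of
the product system `E` and the measurability of `P` are part of the structure. -/
structure Tower [MeasurableSpace G] (E : ProductSystemData P) where
  q : ℕ → P
  r : ℕ → P
  q_succ : ∀ n, q (n + 1) = q n * r n
  exists_mem : ∀ g : G, ∃ n, g * q n ∈ P
  e : ∀ n, E.fiber (r n)
  norm_e : ∀ n, ‖e n‖ = 1
  isProductSystem : E.IsProductSystem
  measurableSet : MeasurableSet (P : Set G)

namespace Tower

variable [MeasurableSpace G] (τ : Tower E) (μ : Measure G)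

/-- The sequence of sections `Fₙ` represents, from the level `N` on, a square integrable section
`g ↦ Fₙ(g qₙ)` of the inductive limits `K(g)`. -/
def IsLevel (F : ℕ → ∀ y, E.fiber y) (N : ℕ) : Prop :=
  (∀ n ≥ N, F (n + 1) = rmul (τ.e n) (F n)) ∧ Integrable (shiftInner (τ.q N) (F N) (F N)) μ

variable {τ μ}

theorem shiftInner_succ {F F' : ℕ → ∀ y, E.fiber y} {n : ℕ}
    (h : F (n + 1) = rmul (τ.e n) (F n)) (h' : F' (n + 1) = rmul (τ.e n) (F' n)) :
    shiftInner (τ.q (n + 1)) (F (n + 1)) (F' (n + 1)) = shiftInner (τ.q n) (F n) (F' n) := by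
  rw [h, h', τ.q_succ, shiftInner_rmul τ.isProductSystem _ (τ.norm_e n)]

theorem shiftInner_eq {F F' : ℕ → ∀ y, E.fiber y} {N : ℕ} (h : τ.IsLevel μ F N)
    (h' : τ.IsLevel μ F' N) {n : ℕ} (hn : N ≤ n) :
    shiftInner (τ.q n) (F n) (F' n) = shiftInner (τ.q N) (F N) (F' N) := by
  induction n, hn using Nat.le_induction with
  | base => rfl
  | succ n hn ih => rw [shiftInner_succ (h.1 n hn) (h'.1 n hn), ih]

theorem IsLevel.mono {F : ℕ → ∀ y, E.fiber y} {N M : ℕ} (h : τ.IsLevel μ F N) (hM : N ≤ M) :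
    τ.IsLevel μ F M :=
  ⟨fun n hn => h.1 n (hM.trans hn), by rw [shiftInner_eq h h hM]; exact h.2⟩

variable [TopologicalSpace G] [IsTopologicalGroup G] [BorelSpace G]

theorem IsLevel.integrable {F F' : ℕ → ∀ y, E.fiber y} {N : ℕ} (h : τ.IsLevel μ F N)
    (h' : τ.IsLevel μ F' N) (hF : F N ∈ E.sections) (hF' : F' N ∈ E.sections) :
    Integrable (shiftInner (τ.q N) (F N) (F' N)) μ :=
  (h.2.norm.add h'.2.norm).mono'
    (measurable_shiftInner τ.isProductSystem τ.measurableSet _ hF hF').aestronglyMeasurable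
    (Eventually.of_forall fun g => norm_shiftInner_le _ _ _ g)

theorem IsLevel.add {F F' : ℕ → ∀ y, E.fiber y} {N : ℕ} (h : τ.IsLevel μ F N)
    (h' : τ.IsLevel μ F' N) (hF : F N ∈ E.sections) (hF' : F' N ∈ E.sections) :
    τ.IsLevel μ (F + F') N := by
  refine ⟨fun n hn => ?_, ?_⟩
  · simp only [Pi.add_apply, h.1 n hn, h'.1 n hn, rmul_add τ.isProductSystem]
  · refine ((h.2.norm.const_mul 2).add (h'.2.norm.const_mul 2)).mono' ?_
      (Eventually.of_forall fun g => norm_shiftInner_add_self_le _ _ _ g)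
    have := τ.isProductSystem.measurableField.add_mem hF hF'
    exact (measurable_shiftInner τ.isProductSystem τ.measurableSet _ this this).aestronglyMeasurable

omit [TopologicalSpace G] [IsTopologicalGroup G] [BorelSpace G] in
theorem IsLevel.smul {F : ℕ → ∀ y, E.fiber y} {N : ℕ} (h : τ.IsLevel μ F N) (c : ℂ) :
    τ.IsLevel μ (c • F) N := by
  refine ⟨fun n hn => ?_, ?_⟩
  · simp only [Pi.smul_apply, h.1 n hn, rmul_smul τ.isProductSystem]
  · refine (h.2.const_mul (starRingEnd ℂ c * c)).congr (Eventually.of_forall fun g => ?_)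
    exact (shiftInner_smul_fun _ (fun _ => c) (starRingEnd ℂ c * c)
      _ g fun _ _ => rfl).symm

variable (τ μ)

/-- The sequences of sections which represent square integrable sections of `g ↦ K(g)`. -/
def limitSections : Submodule ℂ (ℕ → ∀ y, E.fiber y) where
  carrier := {F | (∀ n, F n ∈ E.sections) ∧ ∃ N, τ.IsLevel μ F N}
  add_mem' := by
    rintro F F' ⟨hF, N, hN⟩ ⟨hF', N', hN'⟩
    exact ⟨fun n => τ.isProductSystem.measurableField.add_mem (hF n) (hF' n), max N N',
      (hN.mono (le_max_left _ _)).add (hN'.mono (le_max_right _ _)) (hF _) (hF' _)⟩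
  zero_mem' := ⟨fun n => τ.isProductSystem.measurableField.zero_mem, 0, fun n _ =>
    (rmul_zero τ.isProductSystem _).symm, by
      refine (integrable_zero G ℂ μ).congr (Eventually.of_forall fun g => ?_)
      simp [shiftInner]⟩
  smul_mem' := by
    rintro c F ⟨hF, N, hN⟩
    exact ⟨fun n => τ.isProductSystem.measurableField.smul_mem (hF n) measurable_const, N,
      hN.smul c⟩

/-- The space of square integrable sections of `g ↦ K(g)`, with the `L²` inner product. -/
def LimitSpace : Type _ := τ.limitSections μ

instance : AddCommGroup (τ.LimitSpace μ) := inferInstanceAs (AddCommGroup (τ.limitSections μ))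
instance : Module ℂ (τ.LimitSpace μ) := inferInstanceAs (Module ℂ (τ.limitSections μ))

namespace LimitSpace

variable {τ μ}

/-- The underlying sequence of sections. -/
def seq (F : τ.LimitSpace μ) : ℕ → ∀ y, E.fiber y := F.1

theorem seq_mem (F : τ.LimitSpace μ) (n : ℕ) : F.seq n ∈ E.sections := F.2.1 n

theorem exists_level (F : τ.LimitSpace μ) : ∃ N, τ.IsLevel μ F.seq N := F.2.2

@[simp] theorem seq_add (F F' : τ.LimitSpace μ) : (F + F').seq = F.seq + F'.seq := rfl
@[simp] theorem seq_sub (F F' : τ.LimitSpace μ) : (F - F').seq = F.seq - F'.seq := rfl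
@[simp] theorem seq_smul (c : ℂ) (F : τ.LimitSpace μ) : (c • F).seq = c • F.seq := rfl

/-- The `L²` inner product, read off at any sufficiently high level. -/
def form (F F' : τ.LimitSpace μ) : ℂ :=
  limUnder atTop fun n => ∫ g, shiftInner (τ.q n) (F.seq n) (F'.seq n) g ∂μ

theorem form_eq (F F' : τ.LimitSpace μ) {N : ℕ} (h : τ.IsLevel μ F.seq N)
    (h' : τ.IsLevel μ F'.seq N) :
    form F F' = ∫ g, shiftInner (τ.q N) (F.seq N) (F'.seq N) g ∂μ := by
  refine Tendsto.limUnder_eq (tendsto_const_nhds.congr' ?_)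
  filter_upwards [eventually_ge_atTop N] with n hn
  rw [shiftInner_eq h h' hn]

theorem exists_level₂ (F F' : τ.LimitSpace μ) :
    ∃ N, τ.IsLevel μ F.seq N ∧ τ.IsLevel μ F'.seq N := by
  obtain ⟨N, hN⟩ := F.exists_level
  obtain ⟨N', hN'⟩ := F'.exists_level
  exact ⟨max N N', hN.mono (le_max_left _ _), hN'.mono (le_max_right _ _)⟩

variable (τ μ) in
/-- The axioms of the `L²` inner product. -/
@[reducible]
def core : PreInnerProductSpace.Core ℂ (τ.LimitSpace μ) where
  inner := form
  conj_inner_symm F F' := by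
    obtain ⟨N, h, h'⟩ := exists_level₂ F F'
    rw [form_eq F F' h h', form_eq F' F h' h, ← integral_conj]
    simp only [conj_shiftInner]
  re_inner_nonneg F := by
    obtain ⟨N, h⟩ := F.exists_level
    rw [form_eq F F h h, RCLike.re_eq_complex_re, ← RCLike.re_eq_complex_re, ← integral_re h.2]
    exact integral_nonneg fun g => shiftInner_self_nonneg _ _ g
  add_left F F' F'' := by
    obtain ⟨N, h, h'⟩ := exists_level₂ F F'
    obtain ⟨M, hM⟩ := F''.exists_level
    have h := h.mono (le_max_left N M)
    have h' := h'.mono (le_max_left N M)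
    have h'' := hM.mono (le_max_right N M)
    rw [form_eq (F + F') F'' (h.add h' (F.seq_mem _) (F'.seq_mem _)) h'', form_eq F F'' h h'',
      form_eq F' F'' h' h'', ← integral_add (h.integrable h'' (F.seq_mem _) (F''.seq_mem _))
        (h'.integrable h'' (F'.seq_mem _) (F''.seq_mem _))]
    simp only [seq_add, Pi.add_apply, shiftInner_add_left]
  smul_left F F' c := by
    obtain ⟨N, h, h'⟩ := exists_level₂ F F'
    rw [form_eq (c • F) F' (h.smul c) h', form_eq F F' h h', ← integral_const_mul]
    simp only [seq_smul, Pi.smul_apply, shiftInner_smul_left]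

instance : SeminormedAddCommGroup (τ.LimitSpace μ) :=
  @InnerProductSpace.Core.toSeminormedAddCommGroup ℂ _ _ _ _ (core τ μ)

instance : InnerProductSpace ℂ (τ.LimitSpace μ) := InnerProductSpace.ofCore (core τ μ)

theorem inner_eq (F F' : τ.LimitSpace μ) {N : ℕ} (h : τ.IsLevel μ F.seq N)
    (h' : τ.IsLevel μ F'.seq N) :
    inner ℂ F F' = ∫ g, shiftInner (τ.q N) (F.seq N) (F'.seq N) g ∂μ := form_eq F F' h h'

end LimitSpace

end Tower

end LimitSpace

/-! ### The action on square integrable sections -/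

section Regular

open MeasureTheory ProductSystemData

variable {G : Type*} [Group G] {P : Subsemigroup G} {E : ProductSystemData P}
  [MeasurableSpace G] {τ : Tower E} {μ : Measure G}
  [TopologicalSpace G] [IsTopologicalGroup G] [BorelSpace G]

namespace Tower

theorem IsLevel.lmul [μ.IsMulLeftInvariant] {F : ℕ → ∀ y, E.fiber y} {N : ℕ}
    (h : τ.IsLevel μ F N) {x : P} (u : E.fiber x) : τ.IsLevel μ (fun n => lmul u (F n)) N := by
  refine ⟨fun n hn => ?_, ?_⟩
  · simp only [h.1 n hn, lmul_rmul τ.isProductSystem]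
  · refine ((h.2.comp_mul_left (x : G)⁻¹).const_mul (inner ℂ u u)).congr
      (Eventually.of_forall fun g => ?_)
    have := shiftInner_lmul τ.isProductSystem (τ.q N) u u (F N) (F N) ((x : G)⁻¹ * g)
    rw [mul_inv_cancel_left] at this
    exact this.symm

theorem IsLevel.lmulAdj [μ.IsMulLeftInvariant] [T2Space G] {F : ℕ → ∀ y, E.fiber y} {N : ℕ}
    (h : τ.IsLevel μ F N) (hF : F N ∈ E.sections) {x : P} (u : E.fiber x)
    (hx : ∀ n ≥ N, ∀ z, (∀ y, x * y ≠ z) → F n z = 0) :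
    τ.IsLevel μ (fun n => lmulAdj τ.isProductSystem u (F n)) N := by
  have := τ.isProductSystem.complete
  refine ⟨fun n hn => ?_, ?_⟩
  · simp only [h.1 n hn]
    exact lmulAdj_rmul τ.isProductSystem _ _ _ (hx n hn)
  · refine ((h.2.comp_mul_left (x : G)).norm.const_mul (‖u‖ ^ 2)).mono' ?_
      (Eventually.of_forall fun g => ?_)
    · have := lmulAdj_mem τ.isProductSystem u hF
      exact
        (measurable_shiftInner τ.isProductSystem τ.measurableSet _ this this).aestronglyMeasurable
    · rcases mem_cases (τ.q N) g with ⟨y, hy⟩ | hy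
      · have hy' : x * g * τ.q N = (x * y : P) := by rw [mul_assoc, hy]; rfl
        rw [shiftInner_of_eq _ _ hy, shiftInner_of_eq _ _ hy', inner_self_eq_norm_sq_to_K,
          inner_self_eq_norm_sq_to_K]
        simp only [norm_pow, RCLike.norm_ofReal, abs_norm]
        rw [← mul_pow]
        gcongr
        refine ContinuousLinearMap.le_of_opNorm_le _ ?_ _
        rw [LinearIsometryEquiv.norm_map]
        refine ContinuousLinearMap.opNorm_le_bound _ (norm_nonneg _) fun v => ?_
        rw [(τ.isProductSystem.isTensorAction_mulOp x y).norm_apply]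
      · rw [shiftInner_of_notMem _ _ hy, norm_zero]
        positivity

/-- Restriction of a section of `g ↦ K(g)` to a subset `B` of `G`. -/
def cutoff (τ : Tower E) (B : Set G) (F : ℕ → ∀ y, E.fiber y) (n : ℕ) (y : P) : E.fiber y :=
  B.indicator (fun _ => (1 : ℂ)) (y * (τ.q n : G)⁻¹) • F n y

omit [TopologicalSpace G] [IsTopologicalGroup G] [BorelSpace G] in
theorem shiftInner_cutoff (B : Set G) (F : ℕ → ∀ y, E.fiber y) (n : ℕ) (g : G) :
    shiftInner (τ.q n) (τ.cutoff B F n) (τ.cutoff B F n) g =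
      B.indicator (shiftInner (τ.q n) (F n) (F n)) g := by
  unfold cutoff
  rw [shiftInner_smul_fun _ _ (B.indicator (fun _ => (1 : ℂ)) g)]
  · by_cases hg : g ∈ B <;> simp [hg]
  · rintro y hy
    rw [← hy, mul_inv_cancel_right]
    by_cases hg : g ∈ B <;> simp [hg]

theorem cutoff_mem (B : Set G) (hB : MeasurableSet B) {F : ℕ → ∀ y, E.fiber y} {n : ℕ}
    (hF : F n ∈ E.sections) : τ.cutoff B F n ∈ E.sections := by
  refine τ.isProductSystem.measurableField.smul_mem hF ?_
  exact (measurable_const.indicator hB).comp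
    ((continuous_mul_const _).measurable.comp measurable_subtype_coe)

omit [TopologicalSpace G] [IsTopologicalGroup G] [BorelSpace G] in
theorem IsLevel.cutoff {F : ℕ → ∀ y, E.fiber y} {N : ℕ} (h : τ.IsLevel μ F N) {B : Set G}
    (hB : MeasurableSet B) : τ.IsLevel μ (τ.cutoff B F) N := by
  refine ⟨fun n hn => ?_, ?_⟩
  · unfold Tower.cutoff
    rw [h.1 n hn]
    refine (rmul_smul_fun τ.isProductSystem (τ.e n)
      (c := fun y => B.indicator (fun _ => (1 : ℂ)) (y * (τ.q n : G)⁻¹))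
      (c' := fun y => B.indicator (fun _ => (1 : ℂ)) (y * (τ.q (n + 1) : G)⁻¹)) ?_ (F n)).symm
    intro y
    simp [τ.q_succ, mul_assoc]
  · rw [show shiftInner (τ.q N) (τ.cutoff B F N) (τ.cutoff B F N) = _ from
      funext (shiftInner_cutoff B F N)]
    exact h.2.indicator hB

namespace LimitSpace

theorem norm_sq_eq (F : τ.LimitSpace μ) {N : ℕ} (h : τ.IsLevel μ F.seq N) :
    ‖F‖ ^ 2 = ∫ g, ‖shiftInner (τ.q N) (F.seq N) (F.seq N) g‖ ∂μ := by
  rw [← inner_self_eq_norm_sq (𝕜 := ℂ), inner_eq F F h h, ← integral_re h.2]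
  simp only [norm_shiftInner_self]
  rfl

/-- Dominated convergence, for sections of `g ↦ K(g)` with a common level. -/
theorem tendsto_of_dominated {F : τ.LimitSpace μ} {F' : ℕ → τ.LimitSpace μ} {N : ℕ}
    (h : τ.IsLevel μ F.seq N) (h' : ∀ k, τ.IsLevel μ (F' k).seq N)
    (hb : ∀ k g, ‖shiftInner (τ.q N) ((F' k).seq N - F.seq N) ((F' k).seq N - F.seq N) g‖ ≤
      4 * ‖shiftInner (τ.q N) (F.seq N) (F.seq N) g‖)
    (hl : ∀ g, Tendsto (fun k => ‖shiftInner (τ.q N) ((F' k).seq N - F.seq N)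
      ((F' k).seq N - F.seq N) g‖) atTop (𝓝 0)) :
    Tendsto F' atTop (𝓝 F) := by
  rw [tendsto_iff_norm_sub_tendsto_zero]
  have hsub : ∀ k, τ.IsLevel μ (F' k - F).seq N := fun k => by
    have := (h' k).add (h.smul (-1)) (seq_mem _ _)
      (τ.isProductSystem.measurableField.smul_mem (seq_mem F N) measurable_const)
    rwa [neg_one_smul, ← sub_eq_add_neg] at this
  have h2 : Tendsto (fun k => ‖F' k - F‖ ^ 2) atTop (𝓝 0) := by
    simp only [fun k => norm_sq_eq _ (hsub k)]
    rw [← integral_zero G ℝ (μ := μ)]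
    refine tendsto_integral_of_dominated_convergence
      (fun g => 4 * ‖shiftInner (τ.q N) (F.seq N) (F.seq N) g‖) (fun k => ?_)
      (h.2.norm.const_mul 4) (fun k => Eventually.of_forall fun g => ?_)
      (Eventually.of_forall hl)
    · exact (hsub k).2.norm.aestronglyMeasurable
    · rw [norm_norm]; exact hb k g
  have h3 := (Real.continuous_sqrt.tendsto _).comp h2
  simpa [Function.comp_def, Real.sqrt_sq] using h3

/-- The action of `E(x)` on square integrable sections of `g ↦ K(g)`. -/
def lmul [μ.IsMulLeftInvariant] [T2Space G] (x : P) :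
    E.fiber x →ₗ[ℂ] τ.LimitSpace μ →ₗ[ℂ] τ.LimitSpace μ :=
  LinearMap.mk₂ ℂ (fun u F => ⟨fun n => ProductSystemData.lmul u (F.seq n),
      fun n => lmul_mem τ.measurableSet τ.isProductSystem u (F.seq_mem n),
      F.exists_level.imp fun _ h => h.lmul u⟩)
    (fun u v _ => Subtype.ext (funext fun _ => add_lmul τ.isProductSystem u v _))
    (fun c u _ => Subtype.ext (funext fun _ => smul_lmul τ.isProductSystem c u _))
    (fun u _ _ => Subtype.ext (funext fun _ => lmul_add τ.isProductSystem u _ _))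
    (fun c u _ => Subtype.ext (funext fun _ => lmul_smul τ.isProductSystem u c _))

variable [μ.IsMulLeftInvariant] [T2Space G]

theorem seq_lmul {x : P} (u : E.fiber x) (F : τ.LimitSpace μ) (n : ℕ) :
    (lmul x u F).seq n = ProductSystemData.lmul u (F.seq n) := rfl

theorem lmul_mul {x y : P} (u : E.fiber x) (v : E.fiber y) (F : τ.LimitSpace μ) :
    lmul (x * y) (E.mul u v) F = lmul x u (lmul y v F) :=
  Subtype.ext (funext fun n => ProductSystemData.lmul_mul τ.isProductSystem u v (F.seq n))

theorem inner_lmul {x : P} (u v : E.fiber x) (F F' : τ.LimitSpace μ) :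
    inner ℂ (lmul x u F) (lmul x v F') = inner ℂ u v * inner ℂ F F' := by
  obtain ⟨N, h, h'⟩ := exists_level₂ F F'
  rw [inner_eq _ _ (h.lmul u) (h'.lmul v), inner_eq F F' h h',
    ← integral_mul_left_eq_self _ (x : G), ← integral_const_mul]
  simp only [seq_lmul, shiftInner_lmul τ.isProductSystem]

theorem norm_lmul {x : P} (u : E.fiber x) (F : τ.LimitSpace μ) :
    ‖lmul x u F‖ = ‖u‖ * ‖F‖ := by
  have h := inner_lmul u u F F
  rw [inner_self_eq_norm_sq_to_K, inner_self_eq_norm_sq_to_K, inner_self_eq_norm_sq_to_K] at h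
  have h2 : ‖lmul x u F‖ ^ 2 = (‖u‖ * ‖F‖) ^ 2 := by
    rw [mul_pow]; exact_mod_cast h
  exact (sq_eq_sq₀ (norm_nonneg _) (by positivity)).mp h2

/-- Sections which are carried, at high levels, by `xP` lie in the closed span of `E(x) · V`: they
are the limits of `∑_{n < k} eₙ eₙ* F`, for an orthonormal frame `e` of `E(x)`. -/
theorem mem_closure_of_carried (x : P) (F : τ.LimitSpace μ) {M : ℕ}
    (hx : ∀ n ≥ M, ∀ z, (∀ y, x * y ≠ z) → F.seq n z = 0) :
    F ∈ closure (Submodule.span ℂ {F' : τ.LimitSpace μ | ∃ u F₀, lmul x u F₀ = F'} :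
      Set (τ.LimitSpace μ)) := by
  have := τ.isProductSystem.complete
  have := τ.isProductSystem.separable
  obtain ⟨e, he⟩ := exists_isOrthoFrame (E.fiber x)
  obtain ⟨N₀, hN₀⟩ := F.exists_level
  obtain ⟨N, hN, hx⟩ : ∃ N, τ.IsLevel μ F.seq N ∧
      ∀ n ≥ N, ∀ z, (∀ y, x * y ≠ z) → F.seq n z = 0 :=
    ⟨max N₀ M, hN₀.mono (le_max_left _ _), fun n hn => hx n (le_of_max_le_right hn)⟩
  let S : ℕ → τ.LimitSpace μ := fun i => ⟨fun n => lmulAdj τ.isProductSystem (e i) (F.seq n),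
    fun n => lmulAdj_mem τ.isProductSystem _ (F.seq_mem n), N, hN.lmulAdj (F.seq_mem N) _ hx⟩
  let A : ℕ → τ.LimitSpace μ := fun k => ∑ i ∈ Finset.range k, lmul x (e i) (S i)
  have hA : ∀ k, (A k).seq N = ∑ i ∈ Finset.range k,
      ProductSystemData.lmul (e i) (lmulAdj τ.isProductSystem (e i) (F.seq N)) := by
    intro k
    induction k with
    | zero => rfl
    | succ k ih =>
      rw [Finset.sum_range_succ, ← ih]
      simp only [A, Finset.sum_range_succ]
      rfl
  have hAl : ∀ k, τ.IsLevel μ (A k).seq N := by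
    intro k
    induction k with
    | zero => simpa using! hN.smul 0
    | succ k ih =>
      simp only [A, Finset.sum_range_succ]
      exact ih.add ((hN.lmulAdj (F.seq_mem N) (e k) hx).lmul (e k)) (seq_mem _ _) (seq_mem _ _)
  have key : ∀ g : G, (∃ y : P, g * τ.q N = (x * y : P)) ∨
      ∀ f f' : ∀ y, E.fiber y, (∀ z, (∀ y, x * y ≠ z) → f z = 0) →
        shiftInner (τ.q N) f f' g = 0 := by
    intro g
    rcases mem_cases (τ.q N) g with ⟨z, hz⟩ | hz
    · by_cases hzx : ∃ y, x * y = z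
      · obtain ⟨y, rfl⟩ := hzx
        exact Or.inl ⟨y, hz⟩
      · push Not at hzx
        exact Or.inr fun f f' hf => by rw [shiftInner_of_eq _ _ hz, hf z hzx, inner_zero_left]
    · exact Or.inr fun f f' hf => shiftInner_of_notMem _ _ hz
  have hAx : ∀ k z, (∀ y, x * y ≠ z) → ((A k).seq N - F.seq N) z = 0 := by
    intro k z hz
    rw [Pi.sub_apply, hx N le_rfl z hz, hA, Finset.sum_apply, sub_zero]
    exact Finset.sum_eq_zero fun i _ => lmul_of_notMem _ _ hz
  refine mem_closure_of_tendsto (tendsto_of_dominated (F' := A) hN hAl (fun k g => ?_)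
    fun g => ?_) (Eventually.of_forall fun k => ?_)
  · rcases key g with ⟨y, hy⟩ | h
    · rw [shiftInner_of_eq _ _ hy, shiftInner_of_eq _ _ hy, Pi.sub_apply, hA,
        sum_lmul_lmulAdj_apply τ.isProductSystem, inner_self_eq_norm_sq_to_K,
        inner_self_eq_norm_sq_to_K]
      simp only [norm_pow, RCLike.norm_ofReal, abs_norm]
      have h1 := norm_frameProj_le (τ.isProductSystem.isTensorAction_mulOp x y) he k
        (F.seq N (x * y))
      have h2 := norm_sub_le (frameProj (τ.isProductSystem.mulOp x y) e k (F.seq N (x * y)))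
        (F.seq N (x * y))
      calc _ ≤ (2 * ‖F.seq N (x * y)‖) ^ 2 := by gcongr; linarith
        _ = _ := by ring
    · rw [h _ _ (hAx k), norm_zero]; positivity
  · rcases key g with ⟨y, hy⟩ | h
    · simp only [shiftInner_of_eq _ _ hy, Pi.sub_apply, hA,
        sum_lmul_lmulAdj_apply τ.isProductSystem]
      have h1 := (tendsto_frameProj (τ.isProductSystem.isTensorAction_mulOp x y) he
        (F.seq N (x * y))).sub_const (F.seq N (x * y))
      simpa using (h1.inner (𝕜 := ℂ) h1).norm
    · simp only [h _ _ (hAx _), norm_zero]; exact tendsto_const_nhds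
  · exact Submodule.sum_mem _ fun i _ => Submodule.subset_span ⟨_, _, rfl⟩

/-- `E(x) · V` is total in `V`: every section is the limit of its restrictions to the sets
`{g | x⁻¹ g q_M ∈ P}`, and these restrictions are carried by `xP` at the levels `n ≥ M`. -/
theorem dense_span_lmul (x : P) :
    Dense (Submodule.span ℂ {F' : τ.LimitSpace μ | ∃ u F₀, lmul x u F₀ = F'} :
      Set (τ.LimitSpace μ)) := by
  intro F
  rw [← closure_closure]
  obtain ⟨N, hN⟩ := F.exists_level
  let B : ℕ → Set G := fun M => {g | (x : G)⁻¹ * g * τ.q M ∈ P}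
  have hB : ∀ M, MeasurableSet (B M) := fun M =>
    ((continuous_mul_const _).comp (continuous_const_mul _)).measurable τ.measurableSet
  have hBm : Monotone B := monotone_nat_of_le_succ fun M g hg => by
    change (x : G)⁻¹ * g * τ.q (M + 1) ∈ P
    rw [τ.q_succ, MulMemClass.coe_mul, ← mul_assoc]
    exact P.mul_mem hg (τ.r M).2
  let C : ℕ → τ.LimitSpace μ := fun M => ⟨τ.cutoff (B M) F.seq,
    fun n => cutoff_mem _ (hB M) (F.seq_mem n), N, hN.cutoff (hB M)⟩
  classical
  have hC : ∀ M g, shiftInner (τ.q N) ((C M).seq N - F.seq N) ((C M).seq N - F.seq N) g =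
      (B M)ᶜ.indicator (shiftInner (τ.q N) (F.seq N) (F.seq N)) g := by
    intro M g
    change shiftInner (τ.q N) (τ.cutoff (B M) F.seq N - F.seq N) (τ.cutoff (B M) F.seq N - F.seq N)
      g = _
    rcases mem_cases (τ.q N) g with ⟨y, hy⟩ | hy
    · have hg : (y : G) * (τ.q N : G)⁻¹ = g := by rw [← hy, mul_inv_cancel_right]
      by_cases hgB : g ∈ B M
      · rw [Set.indicator_of_notMem (by simpa using hgB), shiftInner_of_eq _ _ hy]
        simp [Tower.cutoff, hg, hgB]
      · rw [Set.indicator_of_mem (by simpa using hgB), shiftInner_of_eq _ _ hy,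
          shiftInner_of_eq _ _ hy]
        simp [Tower.cutoff, hg, hgB]
    · rw [shiftInner_of_notMem _ _ hy, Set.indicator_apply, shiftInner_of_notMem _ _ hy, ite_self]
  refine mem_closure_of_tendsto (tendsto_of_dominated (F' := C) hN (fun M => hN.cutoff (hB M))
    (fun M g => ?_) fun g => ?_) (Eventually.of_forall fun M => ?_)
  · rw [hC]
    refine (norm_indicator_le_norm_self _ _).trans ?_
    linarith [norm_nonneg (shiftInner (τ.q N) (F.seq N) (F.seq N) g)]
  · refine tendsto_const_nhds.congr' ?_
    obtain ⟨M, hM⟩ := τ.exists_mem ((x : G)⁻¹ * g)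
    filter_upwards [eventually_ge_atTop M] with M' hM'
    have : g ∈ B M' := hBm hM' hM
    rw [hC, Set.indicator_of_notMem (by simpa using this), norm_zero]
  · refine mem_closure_of_carried x (C M) (M := M) fun n hn z hz => ?_
    change Set.indicator _ _ _ • _ = _
    rw [Set.indicator_of_notMem, zero_smul]
    intro h
    have h : (x : G)⁻¹ * (z * (τ.q n : G)⁻¹) * τ.q n ∈ P := hBm hn h
    rw [mul_assoc, inv_mul_cancel_right] at h
    exact hz ⟨_, h⟩ (Subtype.ext (mul_inv_cancel_left _ _))

end LimitSpace

end Tower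

end Regular

/-! ### The essential representation and its existence -/

section Regular

open MeasureTheory ProductSystemData

variable {G : Type*} [Group G] {P : Subsemigroup G} {E : ProductSystemData P}
  [MeasurableSpace G] {τ : Tower E} {μ : Measure G}
  [TopologicalSpace G] [IsTopologicalGroup G] [BorelSpace G]

namespace Tower

namespace LimitSpace

section Measurable

variable [μ.IsMulLeftInvariant] [T2Space G] [SFinite μ] [SecondCountableTopology G]

omit [SecondCountableTopology G] in
/-- Weak measurability of the action on `V`, by integrating the jointly measurable function
`(x, g) ↦ ⟨F'(xg), s(x) F(g)⟩` over `G`. -/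
theorem measurable_inner_lmul {s : ∀ x, E.fiber x} (hs : s ∈ E.sections) (F F' : τ.LimitSpace μ) :
    Measurable fun x => inner ℂ F' (lmul x (s x) F) := by
  obtain ⟨N, h, h'⟩ := exists_level₂ F F'
  let k : P × P → ℂ := fun p => inner ℂ (F'.seq N (p.1 * p.2)) (E.mul (s p.1) (F.seq N p.2))
  have hk : Measurable k := τ.isProductSystem.measurable_mul s hs _ (F.seq_mem N) _ (F'.seq_mem N)
  have hj : MeasurableEmbedding (Prod.map id Subtype.val : P × P → P × G) :=
    MeasurableEmbedding.id.prodMap (MeasurableEmbedding.subtype_coe τ.measurableSet)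
  let k' : P × G → ℂ := Function.extend (Prod.map id Subtype.val) k (fun _ => 0) ∘ fun p =>
    (p.1, p.2 * (τ.q N : G))
  have hk' : Measurable k' := (hj.measurable_extend hk measurable_const).comp
    (measurable_fst.prodMk ((continuous_mul_const _).measurable.comp measurable_snd))
  have heq : (fun x => inner ℂ F' (lmul x (s x) F)) = fun x => ∫ g, k' (x, g) ∂μ := by
    funext x
    rw [inner_eq F' (lmul x (s x) F) h' (h.lmul (s x)), ← integral_mul_left_eq_self _ (x : G)]
    congr 1
    funext g
    rcases mem_cases (τ.q N) g with ⟨y, hy⟩ | hy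
    · have hy' : x * g * τ.q N = (x * y : P) := by rw [mul_assoc, hy]; rfl
      rw [shiftInner_of_eq _ _ hy', seq_lmul, lmul_apply]
      change _ = Function.extend _ k (fun _ => 0) (x, g * (τ.q N : G))
      rw [hy]
      exact (hj.injective.extend_apply k (fun _ => 0) (x, y)).symm
    · have h2 : k' (x, g) = 0 := by
        refine Function.extend_apply' _ _ _ ?_
        rintro ⟨⟨a, y⟩, hay⟩
        have : (y : G) = g * τ.q N := congrArg Prod.snd hay
        exact hy (this ▸ y.2)
      rw [h2]
      rcases mem_cases (τ.q N) (x * g) with ⟨z, hz⟩ | hz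
      · rw [shiftInner_of_eq _ _ hz, seq_lmul, lmul_of_notMem, inner_zero_right]
        rintro y rfl
        rw [MulMemClass.coe_mul, mul_assoc] at hz
        exact hy (mul_left_cancel hz ▸ y.2)
      · exact shiftInner_of_notMem _ _ hz
  rw [heq]
  exact (hk'.stronglyMeasurable.integral_prod_right' (ν := μ)).measurable

/-- The coefficients of `f` in a sequence `e` of sections, as a function on `G × ℕ`. -/
def coeff (e : ℕ → ∀ y, E.fiber y) (a : P) (f : ∀ y, E.fiber y) (p : G × ℕ) : ℂ :=
  shiftInner a (e p.2) f p.1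

omit [μ.IsMulLeftInvariant] [T2Space G] [SFinite μ] [SecondCountableTopology G] in
/-- Parseval's identity, integrated. -/
theorem eLpNorm_coeff {e : ℕ → ∀ y, E.fiber y} (he : ∀ n, e n ∈ E.sections)
    (hfr : ∀ x, IsOrthoFrame fun n => e n x) (F : τ.LimitSpace μ) {N : ℕ}
    (h : τ.IsLevel μ F.seq N) :
    AEStronglyMeasurable (coeff e (τ.q N) (F.seq N)) (μ.prod (Measure.count : Measure ℕ)) ∧
      eLpNorm (coeff e (τ.q N) (F.seq N)) 2 (μ.prod (Measure.count : Measure ℕ)) =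
        ENNReal.ofReal ‖F‖ := by
  have := τ.isProductSystem.complete
  have hm : Measurable (coeff e (τ.q N) (F.seq N)) :=
    measurable_from_prod_countable_left fun n =>
      measurable_shiftInner τ.isProductSystem τ.measurableSet _ (he n) (F.seq_mem N)
  refine ⟨hm.aestronglyMeasurable, ?_⟩
  have hsum : ∀ g, ∑' n, ‖coeff e (τ.q N) (F.seq N) (g, n)‖ₑ ^ (2 : ℝ) =
      ENNReal.ofReal ‖shiftInner (τ.q N) (F.seq N) (F.seq N) g‖ := by
    intro g
    rcases mem_cases (τ.q N) g with ⟨y, hy⟩ | hy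
    · simp only [coeff, shiftInner_of_eq _ _ hy]
      have h1 := (hfr y).hasSum_norm_sq (F.seq N y)
      rw [inner_self_eq_norm_sq_to_K]
      simp only [norm_pow, RCLike.norm_ofReal, abs_norm]
      rw [← h1.tsum_eq, ENNReal.ofReal_tsum_of_nonneg (fun n => by positivity) h1.summable]
      refine tsum_congr fun n => ?_
      rw [ENNReal.ofReal_pow (norm_nonneg _), ofReal_norm]
      norm_cast
    · simp [coeff, shiftInner_of_notMem _ _ hy]
  rw [eLpNorm_eq_lintegral_rpow_enorm_toReal (by norm_num) (by norm_num)]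
  simp only [ENNReal.toReal_ofNat]
  rw [lintegral_prod _ (hm.enorm.pow_const _).aemeasurable]
  simp only [lintegral_count, hsum]
  rw [← ofReal_integral_eq_lintegral_ofReal h.2.norm (Eventually.of_forall fun g => norm_nonneg _),
    ← norm_sq_eq F h, ENNReal.ofReal_rpow_of_nonneg (by positivity) (by norm_num)]
  congr 1
  rw [← Real.sqrt_eq_rpow, Real.sqrt_sq (norm_nonneg _)]

omit [μ.IsMulLeftInvariant] [T2Space G] in
/-- `V` is separable: the sections with a fixed level embed isometrically into `L²(G × ℕ)`, by
their coefficients in a measurable orthonormal frame. -/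
theorem separableSpace : TopologicalSpace.SeparableSpace (τ.LimitSpace μ) := by
  obtain ⟨e, he, hfr⟩ := τ.isProductSystem.measurableField.exists_isOrthoFrame
  let ν : Measure (G × ℕ) := μ.prod (Measure.count : Measure ℕ)
  let V : ℕ → Set (τ.LimitSpace μ) := fun N => {F | τ.IsLevel μ F.seq N}
  have hV : ∀ N, TopologicalSpace.IsSeparable (V N) := by
    intro N
    have hmem : ∀ F : V N, MemLp (coeff e (τ.q N) (F.1.seq N)) 2 ν := fun F => by
      obtain ⟨h1, h2⟩ := eLpNorm_coeff he hfr F.1 F.2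
      exact ⟨h1, by rw [h2]; exact ENNReal.ofReal_lt_top⟩
    have : Fact ((2 : ENNReal) ≠ ⊤) := ⟨by norm_num⟩
    let j : V N → Lp ℂ 2 ν := fun F => (hmem F).toLp _
    have hj : Isometry j := by
      intro F F'
      have hsub : τ.IsLevel μ (F.1 - F'.1).seq N := by
        have := F.2.add (IsLevel.smul F'.2 (-1)) (seq_mem _ _)
          (τ.isProductSystem.measurableField.smul_mem (seq_mem F'.1 N) measurable_const)
        rwa [neg_one_smul, ← sub_eq_add_neg] at this
      have hc : coeff e (τ.q N) (F.1.seq N) - coeff e (τ.q N) (F'.1.seq N) =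
          coeff e (τ.q N) ((F.1 - F'.1).seq N) := by
        funext p
        rcases mem_cases (τ.q N) p.1 with ⟨y, hy⟩ | hy
        · simp [coeff, shiftInner_of_eq _ _ hy]
        · simp [coeff, shiftInner_of_notMem _ _ hy]
      rw [Lp.edist_toLp_toLp, hc, (eLpNorm_coeff he hfr _ hsub).2, Subtype.edist_eq, edist_dist,
        dist_eq_norm]
    have : SecondCountableTopology (V N) := hj.isUniformInducing.isInducing.secondCountableTopology
    exact .of_subtype _
  have hU : (Set.univ : Set (τ.LimitSpace μ)) = ⋃ N, V N := by
    ext F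
    simpa [V] using F.exists_level
  rw [← TopologicalSpace.isSeparable_univ_iff, hU]
  exact .iUnion hV

end Measurable

/-- `V` contains a section of nonzero norm: take a measurable section of `E` of norm one on a set
of positive finite measure, and multiply it from the right by `e₀, e₁, …`. -/
theorem exists_norm_ne_zero [T2Space G] [SigmaFinite μ] [μ.IsOpenPosMeasure]
    (hint : (interior (P : Set G)).Nonempty) : ∃ F : τ.LimitSpace μ, ‖F‖ ≠ 0 := by
  obtain ⟨e, he, hfr⟩ := τ.isProductSystem.measurableField.exists_isOrthoFrame
  have := τ.isProductSystem.nontrivial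
  let A : ℕ → Set G := fun k => {g | shiftInner (τ.q 0) (e k) (e k) g = 1}
  have hAm : ∀ k, MeasurableSet (A k) := fun k =>
    measurable_shiftInner τ.isProductSystem τ.measurableSet _ (he k) (he k)
      (measurableSet_singleton 1)
  have hcov : (· * (τ.q 0 : G)) ⁻¹' interior (P : Set G) ⊆ ⋃ k, A k := by
    intro g hg
    have hgP : g * τ.q 0 ∈ P := interior_subset (s := (P : Set G)) hg
    obtain ⟨k, hk⟩ : ∃ k, e k ⟨_, hgP⟩ ≠ 0 := by
      by_contra! hk
      obtain ⟨v, hv⟩ := exists_ne (0 : E.fiber ⟨_, hgP⟩)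
      have h1 := (hfr ⟨_, hgP⟩).dense v
      have h2 : Set.range (fun n => e n ⟨_, hgP⟩) ⊆ {0} := by
        rintro _ ⟨n, rfl⟩
        exact hk n
      rw [Submodule.span_eq_bot.mpr fun w hw => h2 hw, Submodule.bot_coe, closure_singleton] at h1
      exact hv h1
    refine Set.mem_iUnion.mpr ⟨k, ?_⟩
    change shiftInner (τ.q 0) (e k) (e k) g = 1
    rw [shiftInner_of_eq _ _ (y := ⟨_, hgP⟩) rfl, inner_self_eq_norm_sq_to_K,
      ((hfr ⟨_, hgP⟩).norm_eq k).resolve_left hk]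
    simp
  obtain ⟨k, hk⟩ : ∃ k, μ (A k) ≠ 0 := by
    by_contra! h0
    have hopen : IsOpen ((· * (τ.q 0 : G)) ⁻¹' interior (P : Set G)) :=
      isOpen_interior.preimage (continuous_mul_const _)
    refine (hopen.measure_pos μ ?_).ne' (measure_mono_null hcov (measure_iUnion_null h0))
    obtain ⟨c, hc⟩ := hint
    exact ⟨c * (τ.q 0 : G)⁻¹, by simpa using hc⟩
  obtain ⟨B, hB, hBA, hB0, hBt⟩ := Measure.exists_subset_measure_lt_top (hAm k)
    (pos_iff_ne_zero.mpr hk)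
  let F : ℕ → ∀ y, E.fiber y := fun n => Nat.rec
    (fun y => B.indicator (fun _ => (1 : ℂ)) (y * (τ.q 0 : G)⁻¹) • e k y)
    (fun n f => rmul (τ.e n) f) n
  have hF : ∀ n, F n ∈ E.sections := by
    intro n
    induction n with
    | zero => exact cutoff_mem (F := fun _ => e k) (n := 0) B hB (he k)
    | succ n ih => exact rmul_mem τ.measurableSet τ.isProductSystem _ ih
  have hs : shiftInner (τ.q 0) (F 0) (F 0) = B.indicator fun _ => 1 := by
    funext g
    refine (shiftInner_cutoff B (fun _ => e k) 0 g).trans ?_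
    by_cases hg : g ∈ B
    · rw [Set.indicator_of_mem hg, Set.indicator_of_mem hg]
      exact hBA hg
    · rw [Set.indicator_of_notMem hg, Set.indicator_of_notMem hg]
  have hl : τ.IsLevel μ F 0 := ⟨fun n _ => rfl, by
    rw [hs]
    exact (integrable_indicator_iff hB).mpr (integrableOn_const hBt.ne)⟩
  refine ⟨⟨F, hF, 0, hl⟩, fun h0 => ?_⟩
  have h1 := norm_sq_eq (⟨F, hF, 0, hl⟩ : τ.LimitSpace μ) hl
  rw [h0] at h1
  change _ = ∫ g, ‖shiftInner (τ.q 0) (F 0) (F 0) g‖ ∂μ at h1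
  simp only [hs, norm_indicator_eq_indicator_norm, norm_one] at h1
  rw [integral_indicator_const _ hB] at h1
  have h2 : 0 < μ.real B := ENNReal.toReal_pos hB0.ne' hBt.ne
  simp at h1
  exact h2.ne h1

section Completion

variable [μ.IsMulLeftInvariant] [T2Space G]

/-- The action of `E(x)` on the completion of `V`. -/
def completionOp (τ : Tower E) (μ : Measure G) [μ.IsMulLeftInvariant] (x : P) :
    E.fiber x →ₗ[ℂ] (UniformSpace.Completion (τ.LimitSpace μ) →L[ℂ]
      UniformSpace.Completion (τ.LimitSpace μ)) where
  toFun u := ((lmul x u).mkContinuous ‖u‖ fun F => (norm_lmul u F).le).completion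
  map_add' u v := by
    ext ξ
    induction ξ using UniformSpace.Completion.induction_on with
    | hp => exact isClosed_eq (ContinuousLinearMap.continuous _) (ContinuousLinearMap.continuous _)
    | ih F =>
      simp only [add_apply, ContinuousLinearMap.completion_apply_coe, LinearMap.mkContinuous_apply,
        map_add, ← UniformSpace.Completion.coe_add, LinearMap.add_apply]
  map_smul' c u := by
    ext ξ
    induction ξ using UniformSpace.Completion.induction_on with
    | hp => exact isClosed_eq (ContinuousLinearMap.continuous _) (ContinuousLinearMap.continuous _)
    | ih F =>
      simp only [smul_apply, ContinuousLinearMap.completion_apply_coe,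
        LinearMap.mkContinuous_apply, map_smul, ← UniformSpace.Completion.coe_smul,
        LinearMap.smul_apply, RingHom.id_apply]

theorem completionOp_coe {x : P} (u : E.fiber x) (F : τ.LimitSpace μ) :
    completionOp τ μ x u F = (lmul x u F : τ.LimitSpace μ) :=
  ContinuousLinearMap.completion_apply_coe _ _

theorem isTensorAction_completionOp (x : P) : IsTensorAction (completionOp τ μ x) where
  inner_apply u v ξ η := by
    induction ξ, η using UniformSpace.Completion.induction_on₂ with
    | hp =>
      exact isClosed_eq (by fun_prop) (by fun_prop)
    | ih F F' =>
      rw [completionOp_coe, completionOp_coe, UniformSpace.Completion.inner_coe,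
        UniformSpace.Completion.inner_coe, inner_lmul]
  dense := by
    have h := (UniformSpace.Completion.denseRange_coe (α := τ.LimitSpace μ)).dense_image
      (UniformSpace.Completion.continuous_coe _) (dense_span_lmul (τ := τ) (μ := μ) x)
    refine h.mono ?_
    rintro _ ⟨F, hF, rfl⟩
    change _ ∈ Submodule.span ℂ _
    induction hF using Submodule.span_induction with
    | zero => rw [UniformSpace.Completion.coe_zero]; exact Submodule.zero_mem _
    | add a b _ _ ha hb => rw [UniformSpace.Completion.coe_add]; exact Submodule.add_mem _ ha hb
    | smul c a _ ha => rw [UniformSpace.Completion.coe_smul]; exact Submodule.smul_mem _ c ha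
    | mem F hF =>
      obtain ⟨u, F₀, rfl⟩ := hF
      exact Submodule.subset_span ⟨u, F₀, completionOp_coe u F₀⟩

/-- The essential representation of `E` on the square integrable sections of `g ↦ K(g)`. -/
def essentialRep (τ : Tower E) (μ : Measure G) [μ.IsMulLeftInvariant] [SFinite μ]
    [SecondCountableTopology G] :
    EssentialRep E (UniformSpace.Completion (τ.LimitSpace μ)) where
  op := completionOp τ μ
  isTensorAction := isTensorAction_completionOp
  op_mul x y u v := by
    ext ξ
    induction ξ using UniformSpace.Completion.induction_on with
    | hp => exact isClosed_eq (ContinuousLinearMap.continuous _) (ContinuousLinearMap.continuous _)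
    | ih F =>
      rw [completionOp_coe, lmul_mul, mul_apply_eq_comp, completionOp_coe, completionOp_coe]
  measurable s hs ξ η := by
    obtain ⟨a, ha, hξ⟩ := mem_closure_iff_seq_limit.mp
      (UniformSpace.Completion.denseRange_coe (α := τ.LimitSpace μ) ξ)
    obtain ⟨b, hb, hη⟩ := mem_closure_iff_seq_limit.mp
      (UniformSpace.Completion.denseRange_coe (α := τ.LimitSpace μ) η)
    choose F hF using ha
    choose F' hF' using hb
    refine measurable_of_tendsto_metrizable (f := fun n x =>
      inner ℂ (b n) (completionOp τ μ x (s x) (a n))) (fun n => ?_)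
      (tendsto_pi_nhds.mpr fun x => hη.inner
        (((completionOp τ μ x (s x)).continuous.tendsto ξ).comp hξ))
    simp only [← hF, ← hF', completionOp_coe, UniformSpace.Completion.inner_coe]
    exact measurable_inner_lmul hs (F n) (F' n)

end Completion

end LimitSpace

end Tower

end Regular

section Existence

variable {G : Type*} [Group G] [TopologicalSpace G] [IsTopologicalGroup G]
  [SecondCountableTopology G] {P : Subsemigroup G}

/-- By Lindelöf's theorem countably many of the sets `P d⁻¹` cover `G`. -/
theorem exists_seq_forall_mul_mem (hint : (interior (P : Set G)).Nonempty)
    (hPP : (P : Set G) * (P : Set G)⁻¹ = Set.univ) :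
    ∃ d : ℕ → P, ∀ g : G, ∃ n, g * d n ∈ P := by
  obtain ⟨c, hc⟩ := hint
  have hcP : c ∈ P := interior_subset (s := (P : Set G)) hc
  let U : P → Set G := fun p => (· * (p : G)) ⁻¹' interior (P : Set G)
  have hU : ∀ g, ∃ p, g ∈ U p := by
    intro g
    obtain ⟨a, ha, b, hb, rfl⟩ := Set.mem_mul.mp (hPP ▸ Set.mem_univ g)
    refine ⟨⟨b⁻¹ * c, P.mul_mem hb hcP⟩, ?_⟩
    change a * b * (b⁻¹ * c) ∈ interior (P : Set G)
    rw [mul_assoc, mul_inv_cancel_left]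
    -- `a · interior P` is an open subset of `P`
    have hopen : IsOpen ((a * ·) '' interior (P : Set G)) :=
      (Homeomorph.mulLeft a).isOpenMap _ isOpen_interior
    refine interior_maximal ?_ hopen ⟨c, hc, rfl⟩
    rintro _ ⟨y, hy, rfl⟩
    exact P.mul_mem ha (interior_subset (s := (P : Set G)) hy)
  obtain ⟨T, hT, hTU⟩ := TopologicalSpace.isOpen_iUnion_countable U fun p =>
    isOpen_interior.preimage (continuous_mul_const _)
  have hTU' : ∀ g, ∃ p ∈ T, g ∈ U p := fun g => by
    have : g ∈ ⋃ p ∈ T, U p := hTU ▸ Set.mem_iUnion.mpr (hU g)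
    simpa using this
  obtain ⟨p₀, hp₀, -⟩ := hTU' 1
  obtain ⟨d, rfl⟩ := hT.exists_eq_range ⟨p₀, hp₀⟩
  refine ⟨d, fun g => ?_⟩
  obtain ⟨_, ⟨n, rfl⟩, hn⟩ := hTU' g
  exact ⟨n, interior_subset (s := (P : Set G)) hn⟩

/-- Covering translates `P d₀⁻¹, P d₁⁻¹, …` become increasing when `dₙ` is replaced by a common right
multiple of `dₙ` and its predecessor, which exists because `P P⁻¹ = G`. -/
theorem exists_tower [MeasurableSpace G] (hP : MeasurableSet (P : Set G))
    (hint : (interior (P : Set G)).Nonempty) (hPP : (P : Set G) * (P : Set G)⁻¹ = Set.univ)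
    {E : ProductSystemData P} (hE : E.IsProductSystem) : Nonempty (Tower E) := by
  obtain ⟨d, hd⟩ := exists_seq_forall_mul_mem hint hPP
  -- the Ore condition: two elements of `P` have a common right multiple
  have hOre : ∀ a b : P, ∃ c s : P, a * c = b * s := by
    intro a b
    obtain ⟨c, hc, s, hs, h⟩ := Set.mem_mul.mp
      (hPP ▸ Set.mem_univ ((a : G)⁻¹ * b) : (a : G)⁻¹ * b ∈ (P : Set G) * (P : Set G)⁻¹)
    refine ⟨⟨c, hc⟩, ⟨s⁻¹, hs⟩, Subtype.ext ?_⟩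
    change (a : G) * c = b * s⁻¹
    rw [eq_mul_inv_iff_mul_eq, mul_assoc, h, mul_inv_cancel_left]
  choose c s hcs using hOre
  have := hE.nontrivial
  let q : ℕ → P := fun n => Nat.rec (d 0) (fun n p => p * c p (d (n + 1))) n
  choose e he using fun n => exists_norm_eq (E := E.fiber (c (q n) (d (n + 1)))) zero_le_one
  refine ⟨⟨q, fun n => c (q n) (d (n + 1)), fun n => rfl, fun g => ?_, e, he, hE, hP⟩⟩
  obtain ⟨n, hn⟩ := hd g
  refine ⟨n, ?_⟩
  cases n with
  | zero => exact hn
  | succ n =>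
    have : q (n + 1) = d (n + 1) * s (q n) (d (n + 1)) := hcs _ _
    rw [this, MulMemClass.coe_mul, ← mul_assoc]
    exact P.mul_mem hn (s _ _).2

/-- Every product system over `P` is concrete. -/
theorem ProductSystemData.IsProductSystem.isConcrete [LocallyCompactSpace G] [T2Space G]
    [MeasurableSpace G] [BorelSpace G] (hP : MeasurableSet (P : Set G))
    (hint : (interior (P : Set G)).Nonempty) (hPP : (P : Set G) * (P : Set G)⁻¹ = Set.univ)
    {E : ProductSystemData P} (hE : E.IsProductSystem) : E.IsConcrete := by
  obtain ⟨τ⟩ := exists_tower hP hint hPP hE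
  let μ : MeasureTheory.Measure G := MeasureTheory.Measure.haar
  have := Tower.LimitSpace.separableSpace (τ := τ) (μ := μ)
  obtain ⟨F, hF⟩ := Tower.LimitSpace.exists_norm_ne_zero (τ := τ) (μ := μ) hint
  have : Nontrivial (UniformSpace.Completion (τ.LimitSpace μ)) :=
    ⟨F, 0, fun h => hF (by rw [← UniformSpace.Completion.norm_coe, h, norm_zero])⟩
  exact (Tower.LimitSpace.essentialRep τ μ).isConcrete hE.measurableField hE.complete

end Existence

end

theorem mainTheorem2 {G : Type*} [Group G] [TopologicalSpace G] [IsTopologicalGroup G]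
    [LocallyCompactSpace G] [SecondCountableTopology G] [T2Space G]
    [MeasurableSpace G] [BorelSpace G]
    (P : Subsemigroup G) (hP : MeasurableSet (P : Set G))
    (hPint : (interior (P : Set G)).Nonempty)
    (hPP : (P : Set G) * (P : Set G)⁻¹ = Set.univ)
    (Q : Subsemigroup G) (hQP : Q ≤ P) (hQ : MeasurableSet (Q : Set G))
    (hQcof : IsCofinalIn (Q : Set G) (P : Set G))
    (hQQ : ∃ K : Subgroup G, (K : Set G) = (Q : Set G) * (Q : Set G)⁻¹ ∧ IsClosed (K : Set G))
    (E : ProductSystemData P) (hE : E.IsProductSystem)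
    (hEQ : (E.restrict hQP).IsConcrete) :
    E.IsConcrete := hE.isConcrete hP hPint hPP
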